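/- **Setting.** Let $X$ be a set and let $\hat\Sigma$ be a simplicial complex on $X$, i.e. a family of finite subsets of $X$ that contains $\varnothing$ and is closed under taking subsets; $\dim\sigma=|\sigma|-1$. Write $\tau\prec\sigma$ (or $\sigma\succ\tau$) if $\tau\subseteq\sigma$ and $|\sigma\setminus\tau|=1$. Let $m:\hat\Sigma\to(0,\infty)$. Put $\Sigma=\hat\Sigma$ if $\sum_{\dim v=0}m(v)<\infty$, and $\Sigma=\hat\Sigma\setminus\{\varnothing\}$ otherwise, and assume $\sum_{\sigma\succ\tau}m(\sigma)<\infty$ for every $\tau\in\Sigma$. Let $\Sigma_k$ ($k\ge -1$) be the set of $k$-dimensional $\sigma\in\Sigma$. Let $C(\Sigma)$ be the complex functions on $\Sigma$, $C_c(\Sigma)$ those of finite support, and $\ell^2=\ell^2(\Sigma,m)$ with $\langle f,g\rangle=\sum_\Sigma m f\overline g$. Let $\delta:C(\Sigma)\to C(\Sigma)$ be a coboundary operator: $\delta\omega(\sigma)=\sum_{\tau\prec\sigma}\theta(\tau,\sigma)\,\omega(\tau)$ with $\theta(\tau,\sigma)=\delta 1_\tau(\sigma)\in\{1,-1,0\}$,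 nonzero exactly when $\tau\prec\sigma$, and $\delta\delta=0$. Let $\partial\omega(\rho)=\frac1{m(\rho)}\sum_{\tau\succ\rho}m(\tau)\theta(\rho,\tau)\omega(\tau)$ on $D(\partial)=\{\omega\in C(\Sigma):\sum_{\tau\succ\rho}m(\tau)|\omega(\tau)|<\infty\ \text{for all }\rho\in\Sigma\}\supseteq\ell^2$. Let $\mathcal Q^H(\omega)=\sum_\Sigma m|\delta\omega+\partial\omega|^2\in[0,\infty]$ for $\omega\in D(\partial)$. Let $Q^H_N$ be its restriction to $\{\omega\in\ell^2:\mathcal Q^H(\omega)<\infty\}$, and $Q^H_D$ its restriction to the set of all $\omega\in\ell^2$ for which there are $\omega_n\in C_c(\Sigma)$ with $\|\omega_n-\omega\|^2+\mathcal Q^H(\omega_n-\omega)\to0$. Let $Q^H$ be a closed quadratic form on $\ell^2$ with $Q^H_D\subseteq Q^H\subseteq Q^H_N$, and let $\Delta^H$ (the Hodge Laplacian) be the associated operator: $\omega\in D(\Delta^H)$ and $\Delta^H\omega=\psi$ if and only if $\omega\in D(Q^H)$, $\psi\in\ell^2$ and $Q^H(\omega,\eta)=\langle\psi,\eta\rangle$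 for all $\eta\in D(Q^H)$. For $\rho\in\Sigma$, the link $\mathrm{lk}(\rho)$ is the set of vertices $v\notin\rho$ with $\rho\cup\{v\}\in\Sigma$, equipped with the graph $b_\rho(v,v')=m(\rho\cup\{v,v'\})$ if $v\ne v'$ and $\rho\cup\{v,v'\}\in\Sigma$, and $b_\rho(v,v')=0$ otherwise. A connected graph $b$ is recurrent if its Markov chain with transition probabilities $b(x,y)/\sum_z b(x,z)$, started at any vertex $x$, almost surely visits any vertex $y$ at some time $k>0$; on a one-vertex graph the chain stays put, so such a graph is recurrent. **Theorem (Action of Hodge Laplacians).** Suppose that for all $\rho\in\Sigma$ all connected components of $b_\rho$ are recurrent, and that $\partial\delta\, C_c(\Sigma)\subseteq\ell^2$. Then $\Delta^H$ is a well-defined self-adjoint operator, and every $\omega\in D(\Delta^H)$ satisfies $\omega\in D(\partial)$, $\delta\omega\in D(\partial)$ and $$\Delta^H\omega=\partial\delta\omega+\delta\partial\omega .$$ Hence the action of $\Delta^H$ splits over the degrees: for every $k$ and $\omega\in D(\Delta^H)$, with $\omega_k=1_{\Sigma_k}\omega$, one has $\omega_k,\delta\omega_k\in D(\partial)$ and $$(\Delta^H\omega)_k=\partial\delta\omega_k+\delta\partial\omega_k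 ;$$ in particular $\Delta^H$ maps $D(\Delta^H)\cap\ell^2(\Sigma_k,m)$ into $\ell^2(\Sigma_k,m)$. -/

import Mathlib

open Filter Topology MeasureTheory ProbabilityTheory
open scoped ENNReal ComplexConjugate

noncomputable section

/-! ### Weighted graphs and recurrence -/

/-- A graph over `V`: a symmetric edge weight `b : V × V → [0,∞)` with vanishing diagonal such that
`∑_y b(x,y) < ∞` for all `x`. -/
structure WeightedGraph (V : Type*) where
  b : V → V → ℝ
  nonneg : ∀ x y, 0 ≤ b x y
  symm : ∀ x y, b x y = b y x
  diag : ∀ x, b x x = 0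
  summable : ∀ x, Summable fun y => b x y

namespace WeightedGraph

variable {V : Type*}

/-- The combinatorial graph of a weighted graph: `x ~ y` iff `b(x,y) > 0`. -/
def toSimpleGraph (G : WeightedGraph V) : SimpleGraph V where
  Adj x y := 0 < G.b x y
  symm := ⟨fun x y h => by rw [G.symm y x]; exact h⟩
  loopless := ⟨fun x h => by rw [G.diag x] at h; exact lt_irrefl _ h⟩

/-- The restriction of a weighted graph to a set of vertices. -/
def induce (G : WeightedGraph V) (s : Set V) : WeightedGraph s where
  b x y := G.b x y
  nonneg x y := G.nonneg x y
  symm x y := G.symm x y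
  diag x := G.diag x
  summable x := (G.summable x).comp_injective Subtype.val_injective

open Classical in
/-- One step of the Markov chain of a weighted graph: from `x` it moves to `y` with probability
`b(x,y) / ∑_z b(x,z)`. If `x` has no neighbour at all, the chain stays at `x`. -/
def step (G : WeightedGraph V) (x : V) : PMF V :=
  if h : ∑' y, ENNReal.ofReal (G.b x y) = 0 then PMF.pure x
  else PMF.normalize (fun y => ENNReal.ofReal (G.b x y)) h (G.summable x).tsum_ofReal_ne_top

/-- The law on path space `ℕ → V` (`V` carrying the discrete `σ`-algebra) of the Markov chain
`(Y_n)` of a weighted graph with `Y_0 = x`: the trajectory measure with the transition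
probabilities `step`. -/
def walkLaw (G : WeightedGraph V) (x : V) :
    @Measure (ℕ → V) (@MeasurableSpace.pi ℕ (fun _ => V) fun _ => ⊤) :=
  letI : MeasurableSpace V := ⊤
  letI κ : Kernel V V :=
    { toFun := fun z => (G.step z).toMeasure
      measurable' := measurable_from_top }
  haveI : IsMarkovKernel κ := ⟨fun z => PMF.toMeasure.isProbabilityMeasure (G.step z)⟩
  Kernel.traj (X := fun _ : ℕ => V)
    (fun n => κ.comap (fun p : (i : Finset.Iic n) → V => p ⟨n, by simp⟩)
      (measurable_pi_apply _)) 0 (fun _ => x)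

/-- Recurrence of a (connected) weighted graph: for all `x`, `y`,
`P(Y_k = y for some k > 0 | Y_0 = x) = 1`. -/
def IsRecurrent (G : WeightedGraph V) : Prop :=
  ∀ x y : V, G.walkLaw x {Y | ∃ k : ℕ, 0 < k ∧ Y k = y} = 1

/-- All connected components of the graph, regarded as graphs themselves, are recurrent. -/
def ComponentsRecurrent (G : WeightedGraph V) : Prop :=
  ∀ C : G.toSimpleGraph.ConnectedComponent, (G.induce C.supp).IsRecurrent

end WeightedGraph

/-! ### Weighted simplicial complexes -/

/-- `τ` is a face of `σ` (`σ` is a coface of `τ`): `τ ⊆ σ` and `σ` has exactly one vertex more. -/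
def IsFace {X : Type*} (τ σ : Finset X) : Prop := τ ⊆ σ ∧ σ.card = τ.card + 1

/-- A weighted simplicial complex. `faces` is the full complex `Σ̂`, which contains `∅`; only the
values of `m` on `faces` matter. Local summability at `τ = ∅` is not demanded here: it decides
whether `∅` belongs to `Σ`, see `WeightedComplex.simplices`. -/
structure WeightedComplex (X : Type*) where
  faces : Set (Finset X)
  empty_mem : ∅ ∈ faces
  down_closed : ∀ σ ∈ faces, ∀ τ, τ ⊆ σ → τ ∈ faces
  m : Finset X → ℝ
  m_pos : ∀ σ ∈ faces, 0 < m σ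
  locally_summable : ∀ τ ∈ faces, τ.Nonempty →
    Summable fun σ : {σ : Finset X // σ ∈ faces ∧ IsFace τ σ} => m σ

namespace WeightedComplex

variable {X : Type*} (S : WeightedComplex X)

/-- `Σ`: all of `Σ̂` if the sum of the weights of the vertices is finite, and `Σ̂ \ {∅}`
otherwise. -/
def simplices : Set (Finset X) :=
  {σ | σ ∈ S.faces ∧
    (σ = ∅ → Summable fun v : {v : Finset X // v ∈ S.faces ∧ v.card = 1} => S.m v)}

/-- The simplices of `Σ`, as a type. The space `C(Σ)` is `S.Simplex → ℂ`. -/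
abbrev Simplex : Type _ := {σ : Finset X // σ ∈ S.simplices}

/-- The weight, on `Σ`. -/
def wt (σ : S.Simplex) : ℝ := S.m σ.1

lemma wt_pos (σ : S.Simplex) : 0 < S.wt σ := S.m_pos _ σ.2.1

/-- The cofaces of a simplex in `Σ`. -/
abbrev Coface (τ : S.Simplex) : Type _ := {σ : S.Simplex // IsFace τ.1 σ.1}

/-- Local summability on `Σ`. -/
lemma summable_coface (τ : S.Simplex) : Summable fun σ : S.Coface τ => S.wt σ.1 := by
  rcases Finset.eq_empty_or_nonempty τ.1 with h | h
  · have h1 := τ.2.2 h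
    let g : S.Coface τ → {v : Finset X // v ∈ S.faces ∧ v.card = 1} := fun σ =>
      ⟨σ.1.1, σ.1.2.1, by rw [σ.2.2, h, Finset.card_empty]⟩
    have hg : Function.Injective g := fun a b hab =>
      Subtype.ext (Subtype.ext (congrArg (fun z => z.1) hab))
    exact Summable.comp_injective (i := g) h1 hg
  · have h1 := S.locally_summable τ.1 τ.2.1 h
    let g : S.Coface τ → {σ : Finset X // σ ∈ S.faces ∧ IsFace τ.1 σ} := fun σ =>
      ⟨σ.1.1, σ.1.2.1, σ.2⟩
    have hg : Function.Injective g := fun a b hab =>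
      Subtype.ext (Subtype.ext (congrArg (fun z => z.1) hab))
    exact Summable.comp_injective (i := g) h1 hg

lemma finite_facesOf (σ : S.Simplex) : {τ : S.Simplex | IsFace τ.1 σ.1}.Finite := by
  refine Set.Finite.of_finite_image (f := Subtype.val) ?_ Subtype.val_injective.injOn
  refine (σ.1.powerset.finite_toSet).subset ?_
  rintro _ ⟨τ, hτ, rfl⟩
  simpa using hτ.1

/-- The finitely many faces of `σ` in `Σ`. -/
def facesOf (σ : S.Simplex) : Finset S.Simplex := (S.finite_facesOf σ).toFinset

/-- The characteristic function `1_τ`. -/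
def char (τ : S.Simplex) : S.Simplex → ℂ := Set.indicator {τ} 1

/-- A coboundary operator on `Σ`: a linear operator `δ` on `C(Σ)` with `δ1_τ(σ) ∈ {1, -1, 0}`,
`δ1_τ(σ) ≠ 0` iff `τ` is a face of `σ`, and `δδ = 0`, which acts as the finite sum
`δω(σ) = ∑_{τ ≺ σ} θ(τ,σ) ω(τ)` with `θ(τ,σ) = δ1_τ(σ)`. -/
structure Coboundary where
  toLin : (S.Simplex → ℂ) →ₗ[ℂ] (S.Simplex → ℂ)
  sign : ∀ τ σ, toLin (S.char τ) σ ∈ ({1, -1, 0} : Set ℂ)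
  ne_zero_iff : ∀ τ σ, toLin (S.char τ) σ ≠ 0 ↔ IsFace τ.1 σ.1
  sq_zero : ∀ ω, toLin (toLin ω) = 0
  apply_eq : ∀ ω σ, toLin ω σ = ∑ τ ∈ S.facesOf σ, toLin (S.char τ) σ * ω τ

/-- The dimension `|σ| - 1` of a simplex; it is `-1` for `∅`. -/
def dim (σ : S.Simplex) : ℤ := (σ.1.card : ℤ) - 1

open Classical in
/-- The degree `k` part `ω_k = 1_{Σ_k} ω` of `ω ∈ C(Σ)`. -/
def degreePart (k : ℤ) (ω : S.Simplex → ℂ) : S.Simplex → ℂ := fun σ =>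
  if S.dim σ = k then ω σ else 0

/-! ### Links -/

open Classical in
/-- The link of `ρ ∈ Σ`: the vertices `v` such that `v ∪ ρ` is a coface of `ρ` in `Σ`. -/
def link (ρ : S.Simplex) : Set X :=
  {v | insert v ρ.1 ∈ S.simplices ∧ IsFace ρ.1 (insert v ρ.1)}

open Classical in
lemma notMem_of_mem_link {ρ : S.Simplex} {v : X} (hv : v ∈ S.link ρ) : v ∉ ρ.1 := by
  intro h
  have := hv.2.2
  rw [Finset.insert_eq_self.2 h] at this
  omega

open Classical in
/-- The edge weight `b_ρ` on the link: `b_ρ(v,v') = m(vv'ρ)` if `v ≠ v'` and `vv'ρ` is a simplex,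
and `0` otherwise. -/
def linkWeight (ρ : S.Simplex) (v w : S.link ρ) : ℝ :=
  if v ≠ w ∧ insert v.1 (insert w.1 ρ.1) ∈ S.faces then S.m (insert v.1 (insert w.1 ρ.1)) else 0

lemma linkWeight_comm (ρ : S.Simplex) (v w : S.link ρ) :
    S.linkWeight ρ v w = S.linkWeight ρ w v := by
  classical
  unfold linkWeight
  rw [Finset.insert_comm]
  simp only [ne_comm (a := v) (b := w)]

lemma summable_linkWeight (ρ : S.Simplex) (v : S.link ρ) :
    Summable fun w => S.linkWeight ρ v w := by
  classical
  have h1 := S.locally_summable _ v.2.1.1 (Finset.insert_nonempty _ _)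
  let A : Set (S.link ρ) := {w | v ≠ w ∧ insert v.1 (insert w.1 ρ.1) ∈ S.faces}
  let g : A → {σ : Finset X // σ ∈ S.faces ∧ IsFace (insert v.1 ρ.1) σ} := fun w =>
    ⟨insert v.1 (insert w.1.1 ρ.1), w.2.2, by
      rw [Finset.insert_comm]
      refine ⟨Finset.subset_insert _ _, Finset.card_insert_of_notMem ?_⟩
      intro hmem
      rcases Finset.mem_insert.1 hmem with h | h
      · exact w.2.1 (Subtype.ext h.symm)
      · exact S.notMem_of_mem_link w.1.2 h⟩
  have hg : Function.Injective g := by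
    intro a c hac
    have h2 : insert v.1 (insert a.1.1 ρ.1) = insert v.1 (insert c.1.1 ρ.1) :=
      congrArg (fun z => z.1) hac
    have h3 : a.1.1 ∈ insert v.1 (insert c.1.1 ρ.1) := by rw [← h2]; simp
    rcases Finset.mem_insert.1 h3 with h | h
    · exact absurd (Subtype.ext h.symm) a.2.1
    · rcases Finset.mem_insert.1 h with h | h
      · exact Subtype.ext (Subtype.ext h)
      · exact absurd h (S.notMem_of_mem_link a.1.2)
  have h2 : Summable ((fun w => S.linkWeight ρ v w) ∘ (Subtype.val : A → S.link ρ)) := by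
    refine (Summable.comp_injective (i := g) h1 hg).congr fun w => ?_
    exact (if_pos w.2).symm
  refine (summable_subtype_iff_indicator.1 h2).congr fun w => ?_
  by_cases hw : w ∈ A
  · rw [Set.indicator_of_mem hw]
  · rw [Set.indicator_of_notMem hw]
    unfold linkWeight
    exact (if_neg hw).symm

/-- The graph `b_ρ` over the link of `ρ`. -/
def linkGraph (ρ : S.Simplex) : WeightedGraph (S.link ρ) where
  b := S.linkWeight ρ
  nonneg v w := by
    unfold linkWeight
    split_ifs with h
    · exact (S.m_pos _ h.2).le
    · exact le_rfl
  symm v w := S.linkWeight_comm ρ v w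
  diag v := by simp [linkWeight]
  summable v := S.summable_linkWeight ρ v

/-! ### The Hilbert space `ℓ²(Σ,m)` -/

/-- `f ∈ ℓ²(Σ,m)` for a function `f ∈ C(Σ)`. -/
def IsL2 (f : S.Simplex → ℂ) : Prop := Summable fun σ => S.wt σ * ‖f σ‖ ^ 2

/-- `∑_Σ m|f|² ∈ [0,∞]`. -/
def sqSum (f : S.Simplex → ℂ) : ℝ≥0∞ := ∑' σ, ENNReal.ofReal (S.wt σ * ‖f σ‖ ^ 2)

lemma sqSum_lt_top_iff (f : S.Simplex → ℂ) : S.sqSum f < ∞ ↔ S.IsL2 f := by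
  have h0 : ∀ σ, 0 ≤ S.wt σ * ‖f σ‖ ^ 2 := fun σ => mul_nonneg (S.wt_pos σ).le (sq_nonneg _)
  constructor
  · intro h
    have := ENNReal.summable_toReal h.ne
    exact this.congr fun σ => (ENNReal.toReal_ofReal (h0 σ))
  · intro h
    exact lt_top_iff_ne_top.2 h.tsum_ofReal_ne_top

/-- The function `√m f`, whose unweighted `ℓ²`-norm is the weighted norm of `f`. -/
def scaled (f : S.Simplex → ℂ) : S.Simplex → ℂ := fun σ => (Real.sqrt (S.wt σ) : ℂ) * f σ

lemma norm_scaled_sq (f : S.Simplex → ℂ) (σ : S.Simplex) :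
    ‖S.scaled f σ‖ ^ 2 = S.wt σ * ‖f σ‖ ^ 2 := by
  rw [scaled, norm_mul, mul_pow, Complex.norm_real, Real.norm_eq_abs, sq_abs,
    Real.sq_sqrt (S.wt_pos σ).le]

lemma isL2_iff_scaled (f : S.Simplex → ℂ) : S.IsL2 f ↔ Memℓp (S.scaled f) 2 := by
  rw [memℓp_gen_iff (by norm_num)]
  unfold IsL2
  refine summable_congr fun σ => ?_
  rw [← S.norm_scaled_sq f σ]
  norm_num

lemma scaled_add (f g : S.Simplex → ℂ) : S.scaled (f + g) = S.scaled f + S.scaled g := by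
  funext σ; simp [scaled, mul_add]

lemma scaled_smul (c : ℂ) (f : S.Simplex → ℂ) : S.scaled (c • f) = c • S.scaled f := by
  funext σ; simp [scaled]; ring

/-- The square summable functions, as a subspace of `C(Σ)`. -/
def l2Submodule : Submodule ℂ (S.Simplex → ℂ) where
  carrier := {f | S.IsL2 f}
  add_mem' {f g} hf hg := by
    simp only [Set.mem_ofPred_eq, isL2_iff_scaled] at *
    rw [scaled_add]; exact hf.add hg
  zero_mem' := by simp [IsL2, summable_zero]
  smul_mem' c f hf := by
    simp only [Set.mem_ofPred_eq, isL2_iff_scaled] at *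
    rw [scaled_smul]; exact hf.const_smul c

/-- The space `ℓ²(Σ,m)`; an element `f` has the underlying function `f.1 : C(Σ)`. -/
def L2 : Type _ := S.l2Submodule

instance : AddCommGroup S.L2 := inferInstanceAs (AddCommGroup S.l2Submodule)

instance : Module ℂ S.L2 := inferInstanceAs (Module ℂ S.l2Submodule)

@[simp] lemma L2.coe_add (f g : S.L2) : (f + g).1 = f.1 + g.1 := rfl

@[simp] lemma L2.coe_sub (f g : S.L2) : (f - g).1 = f.1 - g.1 := rfl

@[simp] lemma L2.coe_smul (c : ℂ) (f : S.L2) : (c • f).1 = c • f.1 := rfl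

@[simp] lemma L2.coe_zero : (0 : S.L2).1 = 0 := rfl

/-- `f ↦ √m f`, from `ℓ²(Σ,m)` to the unweighted `ℓ²`. -/
def toLp : S.L2 →ₗ[ℂ] lp (fun _ : S.Simplex => ℂ) 2 where
  toFun f := ⟨S.scaled f.1, (S.isL2_iff_scaled f.1).1 f.2⟩
  map_add' f g := Subtype.ext (S.scaled_add f.1 g.1)
  map_smul' c f := Subtype.ext (S.scaled_smul c f.1)

lemma inner_toLp (f g : S.L2) :
    inner ℂ (S.toLp f) (S.toLp g) = ∑' σ, (S.wt σ : ℂ) * (conj (f.1 σ) * g.1 σ) := by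
  rw [lp.inner_eq_tsum]
  refine tsum_congr fun σ => ?_
  have h : ((Real.sqrt (S.wt σ) : ℂ)) * (Real.sqrt (S.wt σ) : ℂ) = (S.wt σ : ℂ) := by
    rw [← Complex.ofReal_mul, Real.mul_self_sqrt (S.wt_pos σ).le]
  simp only [toLp, LinearMap.coe_mk, AddHom.coe_mk, scaled, RCLike.inner_apply, map_mul,
    Complex.conj_ofReal]
  rw [← h]; ring

lemma toLp_injective : Function.Injective S.toLp := by
  intro f g h
  refine Subtype.ext (funext fun σ => ?_)
  have h1 : S.scaled f.1 σ = S.scaled g.1 σ := congrArg (fun z => z.1 σ) h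
  have h2 : (Real.sqrt (S.wt σ) : ℂ) ≠ 0 :=
    Complex.ofReal_ne_zero.2 (Real.sqrt_pos.2 (S.wt_pos σ)).ne'
  exact mul_left_cancel₀ h2 h1

/-- The inner product `∑_Σ m conj(f) g` on `ℓ²(Σ,m)`, conjugate linear in the first
entry. -/
@[reducible]
def innerCore : InnerProductSpace.Core ℂ S.L2 where
  inner f g := ∑' σ, (S.wt σ : ℂ) * (conj (f.1 σ) * g.1 σ)
  conj_inner_symm f g := by
    rw [← inner_toLp, ← inner_toLp]; exact inner_conj_symm _ _
  re_inner_nonneg f := by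
    rw [← inner_toLp]; exact inner_self_nonneg
  add_left f g h := by
    rw [← inner_toLp, ← inner_toLp, ← inner_toLp, map_add, inner_add_left]
  smul_left f g c := by
    rw [← inner_toLp, ← inner_toLp, map_smul, inner_smul_left]
  definite f h := by
    rw [← inner_toLp] at h
    exact S.toLp_injective ((inner_self_eq_zero.1 h).trans (map_zero _).symm)

instance : NormedAddCommGroup S.L2 := S.innerCore.toNormedAddCommGroup

instance : InnerProductSpace ℂ S.L2 := InnerProductSpace.ofCore S.innerCore.toCore

lemma inner_def (f g : S.L2) :
    inner ℂ f g = ∑' σ, (S.wt σ : ℂ) * (conj (f.1 σ) * g.1 σ) := rfl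

lemma norm_toLp (f : S.L2) : ‖S.toLp f‖ = ‖f‖ := by
  rw [@norm_eq_sqrt_re_inner ℂ _ _ _ _ f, @norm_eq_sqrt_re_inner ℂ _ _ _ _ (S.toLp f),
    inner_toLp, inner_def]

/-- `f ↦ √m f` as a unitary map. -/
def lpEquiv : S.L2 ≃ₗᵢ[ℂ] lp (fun _ : S.Simplex => ℂ) 2 :=
  LinearIsometryEquiv.ofSurjective ⟨S.toLp, S.norm_toLp⟩ (by
    intro g
    have h1 : S.scaled (fun σ => (Real.sqrt (S.wt σ) : ℂ)⁻¹ * g.1 σ) = g.1 := by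
      funext σ
      have h2 : (Real.sqrt (S.wt σ) : ℂ) ≠ 0 :=
        Complex.ofReal_ne_zero.2 (Real.sqrt_pos.2 (S.wt_pos σ)).ne'
      simp only [scaled]
      rw [mul_inv_cancel_left₀ h2]
    refine ⟨⟨fun σ => (Real.sqrt (S.wt σ) : ℂ)⁻¹ * g.1 σ, ?_⟩, Subtype.ext h1⟩
    change S.IsL2 _
    rw [isL2_iff_scaled, h1]
    exact g.2)

instance : CompleteSpace S.L2 :=
  (S.lpEquiv.toIsometryEquiv.completeSpace_iff).2 inferInstance

/-! ### Boundary operator, Hodge form and Hodge Laplacian -/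

/-- The domain `D(∂)`: the `ω ∈ C(Σ)` with `∑_{τ ≻ ρ} m(τ)|ω(τ)| < ∞` for all `ρ ∈ Σ`. -/
def boundaryDomain : Set (S.Simplex → ℂ) :=
  {ω | ∀ ρ : S.Simplex, Summable fun τ : S.Coface ρ => S.wt τ.1 * ‖ω τ.1‖}

/-- `ℓ²(Σ,m) ⊆ D(∂)`. -/
lemma IsL2.mem_boundaryDomain {ω : S.Simplex → ℂ} (h : S.IsL2 ω) : ω ∈ S.boundaryDomain := by
  intro ρ
  have h1 := S.summable_coface ρ
  have h2 : Summable fun τ : S.Coface ρ => S.wt τ.1 * ‖ω τ.1‖ ^ 2 :=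
    Summable.comp_injective (i := Subtype.val) h Subtype.val_injective
  refine Summable.of_nonneg_of_le (fun τ => mul_nonneg (S.wt_pos _).le (norm_nonneg _)) ?_
    (h1.add h2)
  intro τ
  nlinarith [S.wt_pos τ.1, sq_nonneg (‖ω τ.1‖ - 1), norm_nonneg (ω τ.1)]

namespace Coboundary

variable {S} (δ : S.Coboundary)

/-- `θ(τ,σ) = δ1_τ(σ)`. -/
def theta (τ σ : S.Simplex) : ℂ := δ.toLin (S.char τ) σ

/-- The boundary operator
`∂ω(ρ) = (1/m(ρ)) ∑_{τ ≻ ρ} m(τ) θ(ρ,τ) ω(τ)`, meaningful for `ω ∈ D(∂)`. -/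
def boundary (ω : S.Simplex → ℂ) : S.Simplex → ℂ := fun ρ =>
  (S.wt ρ : ℂ)⁻¹ * ∑' τ : S.Coface ρ, (S.wt τ.1 : ℂ) * δ.theta ρ τ.1 * ω τ.1

lemma norm_theta_le (τ σ : S.Simplex) : ‖δ.theta τ σ‖ ≤ 1 := by
  have h : δ.theta τ σ ∈ ({1, -1, 0} : Set ℂ) := δ.sign τ σ
  simp only [Set.mem_insert_iff, Set.mem_singleton_iff] at h
  rcases h with h | h | h <;> simp [h]

lemma summable_boundary {ω : S.Simplex → ℂ} (h : ω ∈ S.boundaryDomain) (ρ : S.Simplex) :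
    Summable fun τ : S.Coface ρ => (S.wt τ.1 : ℂ) * δ.theta ρ τ.1 * ω τ.1 := by
  refine Summable.of_norm_bounded (h ρ) fun τ => ?_
  rw [norm_mul, norm_mul, Complex.norm_real, Real.norm_eq_abs, abs_of_pos (S.wt_pos _)]
  have h1 := δ.norm_theta_le ρ τ.1
  have h2 := (S.wt_pos τ.1).le
  nlinarith [mul_nonneg h2 (norm_nonneg (ω τ.1))]

lemma boundary_add {ω η : S.Simplex → ℂ} (hω : ω ∈ S.boundaryDomain)
    (hη : η ∈ S.boundaryDomain) : δ.boundary (ω + η) = δ.boundary ω + δ.boundary η := by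
  funext ρ
  simp only [boundary, Pi.add_apply, mul_add]
  rw [(δ.summable_boundary hω ρ).tsum_add (δ.summable_boundary hη ρ), mul_add]

lemma boundary_smul (c : ℂ) (ω : S.Simplex → ℂ) :
    δ.boundary (c • ω) = c • δ.boundary ω := by
  funext ρ
  simp only [boundary, Pi.smul_apply, smul_eq_mul]
  rw [mul_left_comm, ← tsum_mul_left (a := c)]
  congr 1
  exact tsum_congr fun τ => by ring

/-- `(δ + ∂)ω`. -/
def dirac (ω : S.Simplex → ℂ) : S.Simplex → ℂ := δ.toLin ω + δ.boundary ω

lemma dirac_add (ω η : S.L2) : δ.dirac (ω + η).1 = δ.dirac ω.1 + δ.dirac η.1 := by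
  rw [L2.coe_add, dirac, map_add,
    δ.boundary_add (IsL2.mem_boundaryDomain S ω.2) (IsL2.mem_boundaryDomain S η.2), dirac, dirac]
  abel

lemma dirac_smul (c : ℂ) (ω : S.L2) : δ.dirac (c • ω).1 = c • δ.dirac ω.1 := by
  rw [L2.coe_smul, dirac, map_smul, boundary_smul, dirac, smul_add]

/-- The Hodge form `𝒬^H(ω) = ∑_Σ m|δω + ∂ω|² ∈ [0,∞]`, for `ω ∈ D(∂)`. -/
def hodgeForm (ω : S.Simplex → ℂ) : ℝ≥0∞ := S.sqSum (δ.dirac ω)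

/-- `D(Q^H_N) = {ω ∈ ℓ² | 𝒬^H(ω) < ∞}`. -/
def neumannDomain : Submodule ℂ S.L2 where
  carrier := {ω | δ.hodgeForm ω.1 < ∞}
  add_mem' {ω η} hω hη := by
    simp only [Set.mem_ofPred_eq, hodgeForm, sqSum_lt_top_iff] at *
    rw [dirac_add]; exact S.l2Submodule.add_mem hω hη
  zero_mem' := by
    have h : δ.dirac (0 : S.L2).1 = 0 := by
      have := δ.dirac_smul 0 0
      simpa using this
    simp only [Set.mem_ofPred_eq, hodgeForm, sqSum_lt_top_iff]
    rw [h]; exact S.l2Submodule.zero_mem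
  smul_mem' c ω hω := by
    simp only [Set.mem_ofPred_eq, hodgeForm, sqSum_lt_top_iff] at *
    rw [dirac_smul]; exact S.l2Submodule.smul_mem c hω

/-- `D(Q^H_D)`: the `ω ∈ ℓ²` for which there are finitely supported `ω_n` with
`‖ω_n - ω‖² + 𝒬^H(ω_n - ω) → 0`. -/
def dirichletDomain : Set S.L2 :=
  {ω | ∃ u : ℕ → S.L2, (∀ n, (Function.support (u n).1).Finite) ∧
    Tendsto (fun n => ENNReal.ofReal (‖u n - ω‖ ^ 2) + δ.hodgeForm (u n - ω).1) atTop (𝓝 0)}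

/-- The operator `(δ + ∂)_N : D(Q^H_N) → ℓ²`. -/
def diracN : δ.neumannDomain →ₗ[ℂ] S.L2 where
  toFun ω := ⟨δ.dirac ω.1.1, (S.sqSum_lt_top_iff _).1 ω.2⟩
  map_add' ω η := Subtype.ext (δ.dirac_add ω.1 η.1)
  map_smul' c ω := Subtype.ext (δ.dirac_smul c ω.1)

/-- A closed quadratic form `Q^H` on `ℓ²` with `Q^H_D ⊆ Q^H ⊆ Q^H_N`. As a restriction of
`Q^H_N` it is given by its domain. Closedness: if `u_n ∈ D(Q^H)` converges to `ω` in `ℓ²` and is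
Cauchy with respect to the form, then `ω ∈ D(Q^H)` and `Q^H(u_n - ω) → 0`. -/
structure ClosedForm where
  domain : Submodule ℂ S.L2
  dirichlet_subset : δ.dirichletDomain ⊆ domain
  le_neumann : domain ≤ δ.neumannDomain
  closed : ∀ (u : ℕ → S.L2) (ω : S.L2), (∀ n, u n ∈ domain) → Tendsto u atTop (𝓝 ω) →
    (∀ ε : ℝ≥0∞, 0 < ε → ∃ N, ∀ j ≥ N, ∀ k ≥ N, δ.hodgeForm (u j - u k).1 < ε) →
    ω ∈ domain ∧ Tendsto (fun n => δ.hodgeForm (u n - ω).1) atTop (𝓝 0)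

namespace ClosedForm

variable {δ} (Q : δ.ClosedForm)

/-- `(δ + ∂)ω ∈ ℓ²` for `ω ∈ D(Q^H)`. -/
def diracQ : Q.domain →ₗ[ℂ] S.L2 := δ.diracN ∘ₗ Submodule.inclusion Q.le_neumann

/-- The sesquilinear form `Q^H(ω,η) = ∑_Σ m (δ+∂)ω conj((δ+∂)η)` on `D(Q^H)`, obtained from the
quadratic form by polarization. -/
def form (ω η : Q.domain) : ℂ := inner ℂ (Q.diracQ η) (Q.diracQ ω)

/-- The graph of the Hodge Laplacian `Δ^H` associated to `Q^H`: the pairs `(ω, ψ)` with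
`ω ∈ D(Q^H)`, `ψ ∈ ℓ²` and `Q^H(ω,η) = ⟨ψ,η⟩` for all `η ∈ D(Q^H)`. -/
def laplacianGraph : Submodule ℂ (S.L2 × S.L2) where
  carrier := {p | ∃ hω : p.1 ∈ Q.domain, ∀ η : Q.domain,
    Q.form ⟨p.1, hω⟩ η = inner ℂ (η : S.L2) p.2}
  add_mem' := by
    rintro p q ⟨hp, hp'⟩ ⟨hq, hq'⟩
    refine ⟨Q.domain.add_mem hp hq, fun η => ?_⟩
    have h : (⟨(p + q).1, Q.domain.add_mem hp hq⟩ : Q.domain) = ⟨p.1, hp⟩ + ⟨q.1, hq⟩ := rfl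
    have h1 := hp' η
    have h2 := hq' η
    simp only [form] at h1 h2 ⊢
    rw [h, map_add, inner_add_right, h1, h2, Prod.snd_add, inner_add_right]
  zero_mem' := by
    refine ⟨Q.domain.zero_mem, fun η => ?_⟩
    have h : (⟨(0 : S.L2 × S.L2).1, Q.domain.zero_mem⟩ : Q.domain) = 0 := rfl
    simp only [form]
    rw [h, map_zero, inner_zero_right, Prod.snd_zero, inner_zero_right]
  smul_mem' := by
    rintro c p ⟨hp, hp'⟩
    refine ⟨Q.domain.smul_mem c hp, fun η => ?_⟩
    have h : (⟨(c • p).1, Q.domain.smul_mem c hp⟩ : Q.domain) = c • ⟨p.1, hp⟩ := rfl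
    have h1 := hp' η
    simp only [form] at h1 ⊢
    rw [h, map_smul, inner_smul_right, h1, Prod.smul_snd, inner_smul_right]

/-- The Hodge Laplacian `Δ^H` associated to `Q^H`: the partially defined linear operator on `ℓ²`
whose graph is `laplacianGraph` (a single-valued relation, because `D(Q^H)` is dense). -/
def hodgeLaplacian : S.L2 →ₗ.[ℂ] S.L2 := Q.laplacianGraph.toLinearPMap

end ClosedForm

end Coboundary

end WeightedComplex

end

/-! The characteristic functions `1_σ` lie in the form domain, and `δ + ∂` is formally symmetric
against them. Testing the equation of the associated operator with `1_σ` therefore gives, pointwise,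
`Δ^H ω = (δ + ∂)(δ + ∂)ω` with `(δ + ∂)ω ∈ ℓ²` (`hodgeLaplacian_eq_dirac_dirac`). What remains is to
expand the square.

The assumption on `∂δ` puts `δω` into `D(∂)` (`toLin_mem_boundaryDomain`). Then `∂ω = (δ + ∂)ω - δω`
is in `D(∂)` as well, all four terms make sense, and `δδ = 0`. The point is `∂∂ω = 0`: the double
sum need not converge absolutely, so it cannot simply be rearranged.

Up to the factor `1/m(ρ)`, `∂∂ω(ρ)` is the total divergence of a flow on the link of `ρ`. This flow
is antisymmetric because `δδ = 0`, has finite energy because `ω ∈ ℓ²`, and has summable divergence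
because `∂ω ∈ D(∂)`. On a recurrent graph such a flow has total divergence zero: the probabilities
`u_n` of hitting a root `o` by time `n` tend to `1` pointwise, while their energy is at most twice
an escape quantity at `o` that tends to `0`. Summation by parts against `u_n` and Young's inequality
finish the argument (`IsRecurrent.tsum_divergence_eq_zero`).

Self-adjointness is the usual theory of closed forms: projecting onto the closed graph of `δ + ∂`
shows that `Δ^H + 1` is onto, which for a densely defined symmetric operator suffices. -/

noncomputable section

/-! ### Avoidance probabilities of a Markov chain -/

section MarkovChain

variable {V : Type*} [MeasurableSpace V] (κ : Kernel V V) [IsMarkovKernel κ]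

/-- The transition kernels, from the history up to time `n`, of the Markov chain with transition
kernel `κ`. -/
def chainKernel (n : ℕ) : Kernel ((i : Finset.Iic n) → V) V :=
  κ.comap (fun p : (i : Finset.Iic n) → V => p ⟨n, by simp⟩) (measurable_pi_apply _)

instance (n : ℕ) : IsMarkovKernel (chainKernel κ n) := by
  unfold chainKernel; infer_instance

/-- The law of the Markov chain with transition kernel `κ` started at `x`. -/
def chainLaw (x : V) : Measure (ℕ → V) :=
  Kernel.traj (X := fun _ : ℕ => V) (chainKernel κ) 0 (fun _ => x)

instance (x : V) : IsProbabilityMeasure (chainLaw κ x) := by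
  unfold chainLaw; infer_instance

lemma lintegral_chainLaw_one (x : V) {g : V → ℝ≥0∞} (hg : Measurable g) :
    ∫⁻ Y, g (Y 1) ∂chainLaw κ x = ∫⁻ z, g z ∂κ x := by
  have h := Kernel.map_traj_succ_self (X := fun _ : ℕ => V) (κ := chainKernel κ) (a := 0)
  have h2 := congrArg (fun η => η (fun _ => x)) h
  rw [Kernel.map_apply _ (by fun_prop)] at h2
  have h3 : ∫⁻ z, g z ∂κ x = ∫⁻ z, g z ∂(chainKernel κ 0 (fun _ => x)) := by
    simp [chainKernel, Kernel.comap_apply]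
  rw [h3, ← h2, lintegral_map hg (by fun_prop)]
  rfl

/-- The Markov property: given the history up to time `n`, the next position has law `κ (Y n)`. -/
lemma lintegral_chainLaw_succ (x : V) (n : ℕ) {φ : ((i : Finset.Iic n) → V) → ℝ≥0∞}
    (hφ : Measurable φ) {g : V → ℝ≥0∞} (hg : Measurable g) :
    ∫⁻ Y, φ (Preorder.frestrictLe (π := fun _ : ℕ => V) n Y) * g (Y (n + 1)) ∂chainLaw κ x =
      ∫⁻ Y, φ (Preorder.frestrictLe (π := fun _ : ℕ => V) n Y) * ∫⁻ z, g z ∂κ (Y n)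
        ∂chainLaw κ x := by
  have h := Kernel.partialTraj_compProd_eq_map_traj (X := fun _ : ℕ => V) (κ := chainKernel κ)
    (Nat.zero_le n) (x₀ := fun _ => x)
  have hF : Measurable fun p : ((i : Finset.Iic n) → V) × V => φ p.1 * g p.2 := by fun_prop
  have h1 : ∫⁻ Y, φ (Preorder.frestrictLe (π := fun _ : ℕ => V) n Y) * g (Y (n + 1))
      ∂chainLaw κ x = ∫⁻ p, φ p.1 * g p.2 ∂((chainLaw κ x).map
        (fun Y => (Preorder.frestrictLe (π := fun _ : ℕ => V) n Y, Y (n + 1)))) := by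
    rw [lintegral_map hF (by fun_prop)]
  have hG : Measurable fun p : (i : Finset.Iic n) → V =>
      φ p * ∫⁻ z, g z ∂κ (p ⟨n, by simp⟩) :=
    hφ.mul (hg.lintegral_kernel.comp (measurable_pi_apply _))
  rw [h1]
  unfold chainLaw
  rw [← h, Measure.lintegral_compProd hF,
    ← Kernel.traj_map_frestrictLe_apply]
  refine Eq.trans ?_ (lintegral_map hG
    (g := Preorder.frestrictLe (π := fun _ : ℕ => V) n) (by fun_prop))
  exact lintegral_congr fun p => lintegral_const_mul (φ p) hg

lemma measurableSet_avoid (o : V) (ho : MeasurableSet {o}) (n : ℕ) :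
    MeasurableSet {Y : ℕ → V | ∀ k, 0 < k → k ≤ n + 1 → Y k ≠ o} := by
  have : {Y : ℕ → V | ∀ k, 0 < k → k ≤ n + 1 → Y k ≠ o} =
      ⋂ k, ⋂ (_ : 0 < k), ⋂ (_ : k ≤ n + 1), (fun Y : ℕ → V => Y k) ⁻¹' {o}ᶜ := by
    ext Y; simp
  rw [this]
  exact MeasurableSet.iInter fun k => MeasurableSet.iInter fun _ => MeasurableSet.iInter fun _ =>
    measurable_pi_apply k ho.compl

variable {κ} in
/-- If `w₀ = 1_{≠ o}` and `w_{n+1} = 1_{≠ o} κ w_n`, then `κ w_n (x)` is the probability that the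
chain started at `x` does not visit `o` at the times `1, …, n + 1`. -/
lemma chainLaw_avoid (o : V) (ho : MeasurableSet {o}) (w : ℕ → V → ℝ≥0∞)
    (hw : ∀ n, Measurable (w n)) (hw0 : w 0 = Set.indicator {o}ᶜ 1)
    (hws : ∀ n, w (n + 1) = Set.indicator {o}ᶜ fun y => ∫⁻ z, w n z ∂κ y) (x : V) (n : ℕ) :
    chainLaw κ x {Y | ∀ k, 0 < k → k ≤ n + 1 → Y k ≠ o} = ∫⁻ z, w n z ∂κ x := by
  have hmeas : ∀ j, MeasurableSet {p : (i : Finset.Iic j) → V | ∀ i, 0 < i.1 → p i ≠ o} := by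
    intro j
    have : {p : (i : Finset.Iic j) → V | ∀ i, 0 < i.1 → p i ≠ o} =
        ⋂ i : Finset.Iic j, ⋂ (_ : 0 < i.1), (fun p => p i) ⁻¹' {o}ᶜ := by
      ext p; simp
    rw [this]
    exact MeasurableSet.iInter fun i => MeasurableSet.iInter fun _ =>
      measurable_pi_apply i ho.compl
  let φ : (j : ℕ) → ((i : Finset.Iic j) → V) → ℝ≥0∞ := fun j =>
    Set.indicator {p | ∀ i, 0 < i.1 → p i ≠ o} 1
  have hφ1 : ∀ (j : ℕ) (Y : ℕ → V), (∀ k, 0 < k → k ≤ j → Y k ≠ o) →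
      φ j (Preorder.frestrictLe (π := fun _ : ℕ => V) j Y) = 1 := fun j Y h =>
    Set.indicator_of_mem (s := {p : (i : Finset.Iic j) → V | ∀ i, 0 < i.1 → p i ≠ o})
      (fun i hi => h i.1 hi (Finset.mem_Iic.1 i.2)) _
  have hφ0 : ∀ (j : ℕ) (Y : ℕ → V), (¬ ∀ k, 0 < k → k ≤ j → Y k ≠ o) →
      φ j (Preorder.frestrictLe (π := fun _ : ℕ => V) j Y) = 0 := fun j Y h =>
    Set.indicator_of_notMem (s := {p : (i : Finset.Iic j) → V | ∀ i, 0 < i.1 → p i ≠ o})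
      (fun h' => h fun k hk hkj => h' ⟨k, Finset.mem_Iic.2 hkj⟩ hk) _
  have hφ : ∀ j, Measurable (φ j) := fun j => measurable_one.indicator (hmeas j)
  have hφs : ∀ (j : ℕ) (g : V → ℝ≥0∞) (Y : ℕ → V),
      φ (j + 1) (Preorder.frestrictLe (π := fun _ : ℕ => V) (j + 1) Y) * g (Y (j + 1)) =
      φ j (Preorder.frestrictLe (π := fun _ : ℕ => V) j Y) *
        Set.indicator {o}ᶜ g (Y (j + 1)) := by
    intro j g Y
    by_cases h1 : ∀ k, 0 < k → k ≤ j → Y k ≠ o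
    · by_cases h2 : Y (j + 1) = o
      · rw [hφ0 (j + 1) Y fun h => h (j + 1) j.succ_pos le_rfl h2, hφ1 j Y h1,
          Set.indicator_of_notMem (by simp [h2])]
        simp
      · rw [hφ1 (j + 1) Y, hφ1 j Y h1, Set.indicator_of_mem (by simpa using h2)]
        intro k hk hkj
        rcases Nat.lt_or_ge j k with h | h
        · rwa [le_antisymm hkj h]
        · exact h1 k hk h
    · rw [hφ0 j Y h1, hφ0 (j + 1) Y fun h => h1 fun k hk hkj => h k hk (hkj.trans j.le_succ),
        zero_mul, zero_mul]
  -- The history is consumed backwards: the Markov property replaces the last position by an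
  -- application of `κ`, and the constraint split off from `φ (j + 1)` turns `κ w_i` into `w_{i+1}`.
  -- Hence `i` must vary in the induction.
  have key : ∀ j i, ∫⁻ Y, φ j (Preorder.frestrictLe (π := fun _ : ℕ => V) j Y) * w i (Y (j + 1))
      ∂chainLaw κ x = ∫⁻ z, w (i + j) z ∂κ x := by
    intro j
    induction j with
    | zero =>
      intro i
      rw [add_zero, ← lintegral_chainLaw_one κ x (hw i)]
      refine lintegral_congr fun Y => ?_
      rw [hφ1 0 Y fun k hk hk0 => absurd hk0 (by omega), one_mul, zero_add]
    | succ j ih =>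
      intro i
      rw [lintegral_chainLaw_succ κ x (j + 1) (hφ _) (hw i)]
      have h1 := ih (i + 1)
      rw [show i + (j + 1) = i + 1 + j by ring, ← h1]
      refine lintegral_congr fun Y => ?_
      rw [hφs j (fun y => ∫⁻ z, w i z ∂κ y) Y, hws]
  have h1 := key n 0
  rw [zero_add] at h1
  rw [← h1, hw0]
  have h2 : ∀ Y : ℕ → V, φ n (Preorder.frestrictLe (π := fun _ : ℕ => V) n Y) *
      Set.indicator {o}ᶜ (1 : V → ℝ≥0∞) (Y (n + 1)) =
      Set.indicator {Y : ℕ → V | ∀ k, 0 < k → k ≤ n + 1 → Y k ≠ o} 1 Y := by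
    intro Y
    rw [← hφs n 1 Y]
    by_cases h : ∀ k, 0 < k → k ≤ n + 1 → Y k ≠ o
    · rw [Set.indicator_of_mem (s := {Y : ℕ → V | ∀ k, 0 < k → k ≤ n + 1 → Y k ≠ o}) h,
        hφ1 (n + 1) Y h]
      simp
    · rw [Set.indicator_of_notMem (s := {Y : ℕ → V | ∀ k, 0 < k → k ≤ n + 1 → Y k ≠ o}) h,
        hφ0 (n + 1) Y h, zero_mul]
  rw [lintegral_congr h2, lintegral_indicator_one (measurableSet_avoid o ho n)]

-- Continuity of the measure from above: the events of avoiding `o` during `1, …, n + 1` decrease to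
-- the event of never visiting `o` at a positive time, a null set.
variable {κ} in
lemma tendsto_avoid_of_recurrent (o : V) (ho : MeasurableSet {o}) (w : ℕ → V → ℝ≥0∞)
    (hw : ∀ n, Measurable (w n)) (hw0 : w 0 = Set.indicator {o}ᶜ 1)
    (hws : ∀ n, w (n + 1) = Set.indicator {o}ᶜ fun y => ∫⁻ z, w n z ∂κ y) (x : V)
    (hx : chainLaw κ x {Y | ∃ k : ℕ, 0 < k ∧ Y k = o} = 1) :
    Tendsto (fun n => ∫⁻ z, w n z ∂κ x) atTop (𝓝 0) := by
  have h1 := tendsto_measure_iInter_atTop (μ := chainLaw κ x)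
    (s := fun n => {Y : ℕ → V | ∀ k, 0 < k → k ≤ n + 1 → Y k ≠ o})
    (fun n => (measurableSet_avoid o ho n).nullMeasurableSet)
    (fun i j hij Y hY k hk hkj => hY k hk (hkj.trans (by omega)))
    ⟨0, measure_ne_top _ _⟩
  have h2 : (⋂ n : ℕ, {Y : ℕ → V | ∀ k, 0 < k → k ≤ n + 1 → Y k ≠ o}) =
      {Y | ∃ k : ℕ, 0 < k ∧ Y k = o}ᶜ := by
    ext Y
    simp only [Set.mem_iInter, Set.mem_ofPred_eq, Set.mem_compl_iff, not_exists, not_and]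
    exact ⟨fun h k hk => h k k hk (by omega), fun h _ k hk _ => h k hk⟩
  have h3 : MeasurableSet {Y : ℕ → V | ∃ k : ℕ, 0 < k ∧ Y k = o} := by
    have : {Y : ℕ → V | ∃ k : ℕ, 0 < k ∧ Y k = o} = ⋃ k, ⋃ (_ : 0 < k),
        (fun Y : ℕ → V => Y k) ⁻¹' {o} := by
      ext Y; simp
    rw [this]
    exact MeasurableSet.iUnion fun k => MeasurableSet.iUnion fun _ =>
      measurable_pi_apply k ho
  rw [h2, (prob_compl_eq_zero_iff h3).2 hx] at h1
  refine h1.congr fun n => ?_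
  exact chainLaw_avoid o ho w hw hw0 hws x n

end MarkovChain

/-! ### Avoidance probabilities of the chain on a weighted graph -/

namespace WeightedGraph

variable {V : Type*} (G : WeightedGraph V)

open Classical in
/-- `avoid o n x` is the probability that the Markov chain started at `x` does not visit `o` at the
times `0, …, n`. -/
def avoid (o : V) : ℕ → V → ℝ≥0∞
  | 0 => Set.indicator {o}ᶜ 1
  | n + 1 => Set.indicator {o}ᶜ fun x => ∑' y, G.step x y * avoid o n y

lemma avoid_le_one (o : V) (n : ℕ) (x : V) : G.avoid o n x ≤ 1 := by
  induction n generalizing x with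
  | zero => exact Set.indicator_apply_le' (fun _ => le_rfl) fun _ => zero_le
  | succ n ih =>
    refine Set.indicator_apply_le' (fun _ => ?_) fun _ => zero_le
    calc ∑' y, G.step x y * G.avoid o n y ≤ ∑' y, G.step x y :=
          ENNReal.tsum_le_tsum fun y => mul_le_of_le_one_right (zero_le) (ih y)
      _ = 1 := PMF.tsum_coe _

lemma avoid_succ_le (o : V) (n : ℕ) (x : V) : G.avoid o (n + 1) x ≤ G.avoid o n x := by
  induction n generalizing x with
  | zero =>
    by_cases hx : x ∈ ({o}ᶜ : Set V)
    · refine (G.avoid_le_one o 1 x).trans (le_of_eq ?_)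
      simp only [avoid]
      rw [Set.indicator_of_mem hx, Pi.one_apply]
    · simp only [avoid]
      rw [Set.indicator_of_notMem hx]
      exact zero_le
  | succ n ih =>
    rw [avoid, avoid]
    exact Set.indicator_le_indicator (ENNReal.tsum_le_tsum fun y => mul_le_mul_right (ih y) _)

lemma avoid_self (o : V) (n : ℕ) : G.avoid o n o = 0 := by
  cases n <;> exact Set.indicator_of_notMem (by simp) _

/-- The measure is a sum of point masses, so no countability of `V` is needed. -/
lemma lintegral_toMeasure_top (p : PMF V) (f : V → ℝ≥0∞) :
    ∫⁻ y, f y ∂(@PMF.toMeasure V ⊤ p) = ∑' y, p y * f y := by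
  let _ : MeasurableSpace V := ⊤
  have h : p.toMeasure = Measure.sum fun a => p a • Measure.dirac a := by
    ext s hs
    rw [PMF.toMeasure_apply _ hs, Measure.sum_apply _ hs]
    refine tsum_congr fun a => ?_
    rw [Measure.smul_apply, Measure.dirac_apply' _ hs, smul_eq_mul]
    by_cases ha : a ∈ s <;> simp [ha]
  rw [h, lintegral_sum_measure]
  refine tsum_congr fun a => ?_
  rw [lintegral_smul_measure, lintegral_dirac' _ measurable_from_top, smul_eq_mul]

lemma IsRecurrent.tendsto_avoid {G : WeightedGraph V} (h : G.IsRecurrent) (o x : V) :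
    Tendsto (fun n => G.avoid o n x) atTop (𝓝 0) := by
  let _ : MeasurableSpace V := ⊤
  let κ : Kernel V V :=
    { toFun := fun z => (G.step z).toMeasure
      measurable' := measurable_from_top }
  have : IsMarkovKernel κ := ⟨fun z => PMF.toMeasure.isProbabilityMeasure (G.step z)⟩
  have h1 := tendsto_avoid_of_recurrent (κ := κ) o trivial (G.avoid o)
    (fun n => measurable_from_top) rfl (fun n => by
      rw [avoid]
      congr 1
      funext y
      exact (lintegral_toMeasure_top (G.step y) _).symm) x (h x o)
  -- `avoid` also forbids `o` at time `0`, whereas recurrence concerns positive times only; dropping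
  -- that indicator gives an upper bound.
  rw [← tendsto_add_atTop_iff_nat 1]
  refine tendsto_of_tendsto_of_tendsto_of_le_of_le tendsto_const_nhds h1 (fun _ => zero_le) ?_
  intro n
  refine (Set.indicator_le_self' (fun _ _ => zero_le) x).trans (le_of_eq ?_)
  exact (lintegral_toMeasure_top (G.step x) _).symm

end WeightedGraph

/-! ### Hitting probabilities as cutoff functions, and divergences of flows -/

namespace WeightedGraph

variable {V : Type*} (G : WeightedGraph V)

/-- The vertex degree `∑_y b(x,y)`. -/
def deg (x : V) : ℝ := ∑' y, G.b x y

lemma deg_nonneg (x : V) : 0 ≤ G.deg x := tsum_nonneg fun y => G.nonneg x y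

lemma tsum_ofReal_b (x : V) : ∑' y, ENNReal.ofReal (G.b x y) = ENNReal.ofReal (G.deg x) :=
  (ENNReal.ofReal_tsum_of_nonneg (G.nonneg x) (G.summable x)).symm

/-- Multiplying by the degree clears the normalization. It also makes the convention at vertices
without neighbours irrelevant, since both sides vanish there. -/
lemma deg_mul_tsum_step (x : V) (f : V → ℝ≥0∞) :
    ENNReal.ofReal (G.deg x) * ∑' y, G.step x y * f y =
      ∑' y, ENNReal.ofReal (G.b x y) * f y := by
  rw [← G.tsum_ofReal_b]
  by_cases h : ∑' y, ENNReal.ofReal (G.b x y) = 0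
  · rw [h, zero_mul]
    refine (ENNReal.tsum_eq_zero.2 fun y => ?_).symm
    rw [ENNReal.tsum_eq_zero.1 h y, zero_mul]
  · rw [← ENNReal.tsum_mul_left]
    refine tsum_congr fun y => ?_
    rw [step, dif_neg h, PMF.normalize_apply, ← mul_assoc, mul_left_comm,
      ENNReal.mul_inv_cancel h (G.summable x).tsum_ofReal_ne_top, mul_one]

/-- `hit o n x` is the probability that the Markov chain started at `x` visits `o` at one of the
times `0, …, n`. -/
def hit (o : V) (n : ℕ) (x : V) : ℝ := 1 - (G.avoid o n x).toReal

lemma avoid_ne_top (o : V) (n : ℕ) (x : V) : G.avoid o n x ≠ ∞ :=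
  ((G.avoid_le_one o n x).trans_lt ENNReal.one_lt_top).ne

lemma hit_le_one (o : V) (n : ℕ) (x : V) : G.hit o n x ≤ 1 :=
  sub_le_self _ ENNReal.toReal_nonneg

lemma hit_nonneg (o : V) (n : ℕ) (x : V) : 0 ≤ G.hit o n x :=
  sub_nonneg.2 (ENNReal.toReal_le_of_le_ofReal zero_le_one (by simpa using G.avoid_le_one o n x))

lemma hit_self (o : V) (n : ℕ) : G.hit o n o = 1 := by
  simp [hit, avoid_self]

lemma hit_zero_of_ne {o x : V} (h : x ≠ o) : G.hit o 0 x = 0 := by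
  have h1 : G.avoid o 0 x = 1 := Set.indicator_of_mem (by simpa using h) _
  simp [hit, h1]

lemma hit_le_succ (o : V) (n : ℕ) (x : V) : G.hit o n x ≤ G.hit o (n + 1) x :=
  sub_le_sub_left (ENNReal.toReal_mono (G.avoid_ne_top o n x) (G.avoid_succ_le o n x)) _

lemma summable_b_mul {x : V} {f : V → ℝ} (h0 : ∀ y, 0 ≤ f y) (h1 : ∀ y, f y ≤ 1) :
    Summable fun y => G.b x y * f y :=
  Summable.of_nonneg_of_le (fun y => mul_nonneg (G.nonneg x y) (h0 y))
    (fun y => mul_le_of_le_one_right (G.nonneg x y) (h1 y)) (G.summable x)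

/-- First-step analysis away from the root. With monotonicity in `n` it makes `hit o n` subharmonic
off `o`, which is what the energy estimate needs. -/
lemma deg_mul_hit_succ {o x : V} (h : x ≠ o) (n : ℕ) :
    G.deg x * G.hit o (n + 1) x = ∑' y, G.b x y * G.hit o n y := by
  have h1 : G.avoid o (n + 1) x = ∑' y, G.step x y * G.avoid o n y := by
    rw [avoid]
    exact Set.indicator_of_mem (by simpa using h) _
  have h2 := G.deg_mul_tsum_step x (G.avoid o n)
  rw [← h1] at h2
  have h3 := congrArg ENNReal.toReal h2
  rw [ENNReal.toReal_mul, ENNReal.toReal_ofReal (G.deg_nonneg x), ENNReal.tsum_toReal_eq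
    fun y => ENNReal.mul_ne_top ENNReal.ofReal_ne_top (G.avoid_ne_top o n y)] at h3
  have h4 : Summable fun y => G.b x y * G.hit o n y :=
    G.summable_b_mul (G.hit_nonneg o n) (G.hit_le_one o n)
  have h5 : ∑' y, G.b x y * G.hit o n y =
      G.deg x - ∑' y, (ENNReal.ofReal (G.b x y) * G.avoid o n y).toReal := by
    have h6 : ∀ y, (ENNReal.ofReal (G.b x y) * G.avoid o n y).toReal =
        G.b x y - G.b x y * G.hit o n y := by
      intro y
      rw [ENNReal.toReal_mul, ENNReal.toReal_ofReal (G.nonneg x y), hit]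
      ring
    rw [tsum_congr h6, (G.summable x).tsum_sub h4, deg]
    ring
  rw [h5, ← h3, hit]
  ring

/-- The flow `b(x,y)u(x)` out of `x`, on pairs of vertices, is summable if `u` is summable with
respect to the degrees. -/
lemma summable_prod_b_mul {u : V → ℝ} (h0 : ∀ x, 0 ≤ u x)
    (hu : Summable fun x => G.deg x * u x) :
    Summable fun p : V × V => G.b p.1 p.2 * u p.1 := by
  have h1 : 0 ≤ fun p : V × V => G.b p.1 p.2 * u p.1 := fun p => mul_nonneg (G.nonneg _ _) (h0 _)
  rw [summable_prod_of_nonneg h1]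
  have h2 : ∀ x, Summable fun y => G.b x y * u x := fun x => (G.summable x).mul_right (u x)
  have h3 : ∀ x, G.deg x * u x = ∑' y, G.b x y * u x := fun x => tsum_mul_right.symm
  exact ⟨h2, hu.congr h3⟩

/-- By symmetry of `b`, one step of the chain preserves the total mass with respect to the degrees,
and the root adds at most `deg o`. So `hit o n` can serve as a cutoff although its support may be
infinite when vertices have infinitely many neighbours. -/
lemma summable_deg_mul_hit (o : V) (n : ℕ) : Summable fun x => G.deg x * G.hit o n x := by
  classical
  induction n with
  | zero =>
    refine summable_of_ne_finset_zero (s := {o}) fun x hx => ?_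
    rw [G.hit_zero_of_ne (by simpa using hx), mul_zero]
  | succ n ih =>
    have h1 := (G.summable_prod_b_mul (G.hit_nonneg o n) ih).prod_symm.prod
    have h2 : Summable fun x => if x = o then G.deg o else 0 :=
      summable_of_ne_finset_zero (s := {o}) fun x hx => if_neg (by simpa using hx)
    refine Summable.of_nonneg_of_le
      (fun x => mul_nonneg (G.deg_nonneg x) (G.hit_nonneg o _ x)) (fun x => ?_) (h1.add h2)
    have h3 : ∑' y, G.b y x * G.hit o n y = ∑' y, G.b x y * G.hit o n y :=
      tsum_congr fun y => by rw [G.symm]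
    simp only [Prod.swap, h3]
    by_cases hx : x = o
    · subst hx
      rw [if_pos rfl, G.hit_self, mul_one]
      exact le_add_of_nonneg_left
        (tsum_nonneg fun y => mul_nonneg (G.nonneg _ _) (G.hit_nonneg _ _ _))
    · rw [G.deg_mul_hit_succ hx, if_neg hx, add_zero]

/-- The Dirichlet energy of the hitting probabilities is controlled by the escape probability. -/
lemma energy_hit_le (o : V) (n : ℕ) :
    (Summable fun p : V × V => G.b p.1 p.2 * (G.hit o n p.1 - G.hit o n p.2) ^ 2) ∧
    ∑' p : V × V, G.b p.1 p.2 * (G.hit o n p.1 - G.hit o n p.2) ^ 2 ≤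
      2 * ∑' y, G.b o y * (1 - G.hit o n y) := by
  classical
  set u := G.hit o n with hu
  have u0 := G.hit_nonneg o n
  have u1 := G.hit_le_one o n
  rw [← hu] at u0 u1
  have hs := G.summable_prod_b_mul u0 (G.summable_deg_mul_hit o n)
  have hf : Summable fun p : V × V => G.b p.1 p.2 * (u p.1 - u p.2) * u p.1 := by
    refine Summable.of_norm_bounded hs fun p => ?_
    rw [Real.norm_eq_abs, abs_mul, abs_mul, abs_of_nonneg (G.nonneg _ _), abs_of_nonneg (u0 p.1)]
    refine mul_le_mul_of_nonneg_right (mul_le_of_le_one_right (G.nonneg _ _) ?_) (u0 _)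
    rw [abs_le]
    constructor <;> linarith [u0 p.1, u0 p.2, u1 p.1, u1 p.2]
  -- Green's formula: the energy is `2 ∑_x u(x) ∑_y b(x,y)(u(x) - u(y))`.
  have hsplit : ∀ p : V × V, G.b p.1 p.2 * (u p.1 - u p.2) ^ 2 =
      G.b p.1 p.2 * (u p.1 - u p.2) * u p.1 +
        G.b p.swap.1 p.swap.2 * (u p.swap.1 - u p.swap.2) * u p.swap.1 := by
    intro p
    rw [Prod.fst_swap, Prod.snd_swap, G.symm p.2 p.1]
    ring
  have hfs := hf.prod_symm
  refine ⟨(hf.add hfs).congr fun p => (hsplit p).symm, ?_⟩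
  have hswap : ∑' p : V × V, G.b p.swap.1 p.swap.2 * (u p.swap.1 - u p.swap.2) * u p.swap.1 =
      ∑' p : V × V, G.b p.1 p.2 * (u p.1 - u p.2) * u p.1 :=
    (Equiv.prodComm V V).tsum_eq (fun p : V × V => G.b p.1 p.2 * (u p.1 - u p.2) * u p.1)
  rw [tsum_congr hsplit, hf.tsum_add hfs, hswap, ← two_mul]
  refine mul_le_mul_of_nonneg_left ?_ zero_le_two
  rw [hf.tsum_prod]
  have h2 : Summable fun x => if x = o then ∑' y, G.b o y * (1 - u y) else 0 :=
    summable_of_ne_finset_zero (s := {o}) fun x hx => if_neg (by simpa using hx)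
  -- Off the root the inner sum is `deg x` times `hit o n x - hit o (n + 1) x`, hence not positive.
  -- Only the root, where `u = 1`, can contribute positively.
  have h3 := hf.prod.tsum_le_tsum (g := fun x => if x = o then ∑' y, G.b o y * (1 - u y) else 0)
    (fun x => ?_) h2
  · rwa [tsum_ite_eq] at h3
  · simp only
    by_cases hx : x = o
    · subst hx
      rw [if_pos rfl]
      refine le_of_eq (tsum_congr fun y => ?_)
      rw [show u x = 1 from G.hit_self x n, mul_one]
    · rw [if_neg hx, tsum_mul_right]
      refine mul_nonpos_of_nonpos_of_nonneg ?_ (u0 x)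
      have h4 : ∑' y, G.b x y * (u x - u y) = G.deg x * u x - ∑' y, G.b x y * u y := by
        rw [deg, ← tsum_mul_right,
          ← ((G.summable x).mul_right _).tsum_sub (G.summable_b_mul u0 u1)]
        exact tsum_congr fun y => by ring
      rw [h4, ← G.deg_mul_hit_succ hx]
      exact sub_nonpos.2 (mul_le_mul_of_nonneg_left (G.hit_le_succ o n x) (G.deg_nonneg x))

variable {G}

lemma IsRecurrent.tendsto_hit (h : G.IsRecurrent) (o x : V) :
    Tendsto (fun n => G.hit o n x) atTop (𝓝 1) := by
  have h1 := (ENNReal.tendsto_toReal ENNReal.zero_ne_top).comp (h.tendsto_avoid o x)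
  have h2 := h1.const_sub 1
  simpa [hit] using h2

/-- On a recurrent graph, the total divergence of an antisymmetric flow of finite energy with
summable divergence vanishes. -/
theorem IsRecurrent.tsum_divergence_eq_zero (h : G.IsRecurrent) {a : V → V → ℂ}
    (ha : ∀ x y, a y x = -a x y)
    (hE : Summable fun p : V × V => G.b p.1 p.2 * ‖a p.1 p.2‖ ^ 2)
    (hd : Summable fun x => ‖∑' y, (G.b x y : ℂ) * a x y‖) :
    ∑' x, ∑' y, (G.b x y : ℂ) * a x y = 0 := by
  rcases isEmpty_or_nonempty V with hV | ⟨⟨o⟩⟩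
  · exact tsum_empty
  set d : V → ℂ := fun x => ∑' y, (G.b x y : ℂ) * a x y with hdd
  set A : ℝ := ∑' p : V × V, G.b p.1 p.2 * ‖a p.1 p.2‖ ^ 2
  have hA0 : 0 ≤ A := tsum_nonneg fun p => mul_nonneg (G.nonneg _ _) (sq_nonneg _)
  -- The divergence cut off by hitting probabilities. It converges to the total divergence by
  -- dominated convergence, and the energy bound will force its limit to be zero.
  let T : ℕ → ℂ := fun n => ∑' x, (G.hit o n x : ℂ) * d x
  have hT : Tendsto T atTop (𝓝 (∑' x, d x)) := by
    refine tendsto_tsum_of_dominated_convergence hd (fun x => ?_) (Eventually.of_forall fun n x => ?_)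
    · have h1 : Tendsto (fun n => (G.hit o n x : ℂ)) atTop (𝓝 ((1 : ℝ) : ℂ)) :=
        (Complex.continuous_ofReal.tendsto 1).comp (h.tendsto_hit o x)
      simpa using h1.mul_const (d x)
    · rw [norm_mul, Complex.norm_real, Real.norm_eq_abs, abs_of_nonneg (G.hit_nonneg o n x)]
      exact mul_le_of_le_one_left (norm_nonneg _) (G.hit_le_one o n x)
  let L : ℕ → ℝ := fun n => ∑' y, G.b o y * (1 - G.hit o n y)
  have hL : Tendsto L atTop (𝓝 0) := by
    have h1 : Tendsto L atTop (𝓝 (∑' y : V, (0 : ℝ))) := by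
      refine tendsto_tsum_of_dominated_convergence (G.summable o) (fun y => ?_)
        (Eventually.of_forall fun n y => ?_)
      · simpa using ((h.tendsto_hit o y).const_sub 1).const_mul (G.b o y)
      · rw [Real.norm_eq_abs, abs_of_nonneg
          (mul_nonneg (G.nonneg _ _) (sub_nonneg.2 (G.hit_le_one o n y)))]
        exact mul_le_of_le_one_right (G.nonneg _ _) (sub_le_self _ (G.hit_nonneg o n y))
    simpa using h1
  have hbound : ∀ ε : ℝ, 0 < ε → ∀ n, 2 * ‖T n‖ ≤ ε * A + ε⁻¹ * (2 * L n) := by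
    intro ε hε n
    set u := G.hit o n with hu
    have u0 := G.hit_nonneg o n
    have u1 := G.hit_le_one o n
    rw [← hu] at u0 u1
    have hs := G.summable_prod_b_mul u0 (G.summable_deg_mul_hit o n)
    -- Since `0 ≤ u ≤ 1`, `u|a| ≤ u + |a|²`; with the cutoff the double sum thus converges
    -- absolutely and may be symmetrized.
    have hF : Summable fun p : V × V => (u p.1 : ℂ) * ((G.b p.1 p.2 : ℂ) * a p.1 p.2) := by
      refine Summable.of_norm_bounded (hs.add hE) fun p => ?_
      rw [norm_mul, norm_mul, Complex.norm_real, Complex.norm_real, Real.norm_eq_abs,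
        Real.norm_eq_abs, abs_of_nonneg (G.nonneg _ _), abs_of_nonneg (u0 _)]
      have hu2 : u p.1 * ‖a p.1 p.2‖ ≤ u p.1 + ‖a p.1 p.2‖ ^ 2 := by
        nlinarith [u0 p.1, u1 p.1, norm_nonneg (a p.1 p.2), sq_nonneg (‖a p.1 p.2‖ - u p.1),
          mul_nonneg (u0 p.1) (sub_nonneg.2 (u1 p.1))]
      calc u p.1 * (G.b p.1 p.2 * ‖a p.1 p.2‖) = G.b p.1 p.2 * (u p.1 * ‖a p.1 p.2‖) := by ring
        _ ≤ G.b p.1 p.2 * (u p.1 + ‖a p.1 p.2‖ ^ 2) :=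
          mul_le_mul_of_nonneg_left hu2 (G.nonneg _ _)
        _ = _ := by ring
    have hT1 : T n = ∑' p : V × V, (u p.1 : ℂ) * ((G.b p.1 p.2 : ℂ) * a p.1 p.2) := by
      rw [hF.tsum_prod]
      exact tsum_congr fun x => tsum_mul_left.symm
    have hT2 : T n = ∑' p : V × V,
        (u p.swap.1 : ℂ) * ((G.b p.swap.1 p.swap.2 : ℂ) * a p.swap.1 p.swap.2) := by
      rw [hT1]
      exact ((Equiv.prodComm V V).tsum_eq
        fun p : V × V => (u p.1 : ℂ) * ((G.b p.1 p.2 : ℂ) * a p.1 p.2)).symm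
    -- Summation by parts: averaging over both orientations and using antisymmetry of `a` replaces
    -- `u(x)` by `u(x) - u(y)`.
    have hT3 : 2 * T n = ∑' p : V × V,
        ((u p.1 - u p.2 : ℝ) : ℂ) * ((G.b p.1 p.2 : ℂ) * a p.1 p.2) := by
      rw [two_mul]
      nth_rw 1 [hT1]
      rw [hT2, ← hF.tsum_add hF.prod_symm]
      refine tsum_congr fun p => ?_
      rw [Prod.fst_swap, Prod.snd_swap, G.symm p.2 p.1, ha p.1 p.2]
      push_cast
      ring
    obtain ⟨hE1, hE2⟩ := G.energy_hit_le o n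
    rw [← hu] at hE1 hE2
    have hsum := (hE.mul_left ε).add (hE1.mul_left ε⁻¹)
    calc 2 * ‖T n‖ = ‖2 * T n‖ := by rw [norm_mul]; simp
      _ ≤ ∑' p : V × V, (ε * (G.b p.1 p.2 * ‖a p.1 p.2‖ ^ 2) +
            ε⁻¹ * (G.b p.1 p.2 * (u p.1 - u p.2) ^ 2)) := by
          rw [hT3]
          refine tsum_of_norm_bounded hsum.hasSum fun p => ?_
          rw [norm_mul, norm_mul, Complex.norm_real, Complex.norm_real, Real.norm_eq_abs,
            Real.norm_eq_abs, abs_of_nonneg (G.nonneg _ _)]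
          have hy : |u p.1 - u p.2| * ‖a p.1 p.2‖ ≤
              ε * ‖a p.1 p.2‖ ^ 2 + ε⁻¹ * (u p.1 - u p.2) ^ 2 := by
            rw [← sq_abs (u p.1 - u p.2)]
            have h1 : ε * ε⁻¹ = 1 := mul_inv_cancel₀ hε.ne'
            have h2 : 0 ≤ ε * (‖a p.1 p.2‖ - ε⁻¹ * |u p.1 - u p.2|) ^ 2 := by positivity
            have h3 : ε * (‖a p.1 p.2‖ - ε⁻¹ * |u p.1 - u p.2|) ^ 2 = ε * ‖a p.1 p.2‖ ^ 2
                - (ε * ε⁻¹) * 2 * (|u p.1 - u p.2| * ‖a p.1 p.2‖)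
                + (ε * ε⁻¹) * ε⁻¹ * |u p.1 - u p.2| ^ 2 := by ring
            rw [h1] at h3
            have h4 : 0 ≤ |u p.1 - u p.2| * ‖a p.1 p.2‖ := by positivity
            linarith
          calc |u p.1 - u p.2| * (G.b p.1 p.2 * ‖a p.1 p.2‖)
              = G.b p.1 p.2 * (|u p.1 - u p.2| * ‖a p.1 p.2‖) := by ring
            _ ≤ G.b p.1 p.2 * (ε * ‖a p.1 p.2‖ ^ 2 + ε⁻¹ * (u p.1 - u p.2) ^ 2) :=
              mul_le_mul_of_nonneg_left hy (G.nonneg _ _)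
            _ = _ := by ring
      _ = ε * A + ε⁻¹ * ∑' p : V × V, G.b p.1 p.2 * (u p.1 - u p.2) ^ 2 := by
          rw [(hE.mul_left ε).tsum_add (hE1.mul_left ε⁻¹), tsum_mul_left, tsum_mul_left]
      _ ≤ ε * A + ε⁻¹ * (2 * L n) := by
          have := mul_le_mul_of_nonneg_left hE2 (inv_nonneg.2 hε.le)
          exact add_le_add le_rfl this
  have hlim : ∀ ε : ℝ, 0 < ε → 2 * ‖∑' x, d x‖ ≤ ε * A := by
    intro ε hε
    have h1 : Tendsto (fun n => ε * A + ε⁻¹ * (2 * L n)) atTop (𝓝 (ε * A)) := by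
      simpa using ((hL.const_mul 2).const_mul ε⁻¹).const_add (ε * A)
    exact le_of_tendsto_of_tendsto' (hT.norm.const_mul 2) h1 (hbound ε hε)
  have h0 : 2 * ‖∑' x, d x‖ ≤ 0 := by
    refine le_of_forall_pos_le_add fun η hη => ?_
    -- `A + 1` rather than `A`, because the energy `A` may vanish.
    have h1 := hlim (η / (A + 1)) (by positivity)
    have h2 : η / (A + 1) * A ≤ η := by
      rw [div_mul_eq_mul_div, div_le_iff₀ (by positivity)]
      nlinarith
    linarith
  exact norm_le_zero_iff.1 (by linarith)

/-- On a graph all of whose connected components are recurrent, the total divergence of an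
antisymmetric flow of finite energy with summable divergence vanishes. -/
theorem ComponentsRecurrent.tsum_divergence_eq_zero (h : G.ComponentsRecurrent) {a : V → V → ℂ}
    (ha : ∀ x y, a y x = -a x y)
    (hE : Summable fun p : V × V => G.b p.1 p.2 * ‖a p.1 p.2‖ ^ 2)
    (hd : Summable fun x => ‖∑' y, (G.b x y : ℂ) * a x y‖) :
    ∑' x, ∑' y, (G.b x y : ℂ) * a x y = 0 := by
  let comp : V → G.toSimpleGraph.ConnectedComponent := G.toSimpleGraph.connectedComponentMk
  let e : (Σ C, {x : V // comp x = C}) ≃ V := Equiv.sigmaFiberEquiv comp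
  have hd' : Summable fun x => ∑' y, (G.b x y : ℂ) * a x y := hd.of_norm
  -- No edge of positive weight leaves a component, so divergence is computed inside it.
  have hcomp : ∀ (C : G.toSimpleGraph.ConnectedComponent) (x : C.supp),
      ∑' y : C.supp, (G.b x y : ℂ) * a x y = ∑' y, (G.b x y : ℂ) * a x y := by
    intro C x
    refine tsum_subtype_eq_of_support_subset (f := fun y => (G.b x y : ℂ) * a x y) fun y hy => ?_
    have h1 : 0 < G.b x y := by
      refine lt_of_le_of_ne (G.nonneg _ _) fun h0 => hy ?_
      simp [← h0]
    have h2 : G.toSimpleGraph.Adj x y := h1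
    have h3 := x.2
    rw [SimpleGraph.ConnectedComponent.mem_supp_iff] at h3 ⊢
    rw [← h3]
    exact (SimpleGraph.ConnectedComponent.sound h2.reachable).symm
  have he := (e.summable_iff.2 hd').tsum_sigma
  rw [← e.tsum_eq]
  refine he.trans ((tsum_congr fun C => ?_).trans tsum_zero)
  have h1 := (h C).tsum_divergence_eq_zero (a := fun x y => a x y) (fun x y => ha x y)
    (hE.comp_injective (i := fun p : C.supp × C.supp => (p.1.1, p.2.1))
      (Subtype.val_injective.prodMap Subtype.val_injective))
    (by
      refine (hd.comp_injective (i := fun x : C.supp => x.1) Subtype.val_injective).congr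
        fun x => ?_
      exact congrArg norm (hcomp C x).symm)
  rw [← h1]
  exact tsum_congr fun x => (hcomp C x).symm

end WeightedGraph

/-! ### Self-adjoint operators from closed forms -/

section Hilbert

variable {E F : Type*} [NormedAddCommGroup E] [InnerProductSpace ℂ E] [CompleteSpace E]
  [NormedAddCommGroup F] [InnerProductSpace ℂ F] [CompleteSpace F]

/-- A densely defined symmetric operator `A` with `A + 1` surjective is self-adjoint. -/
theorem LinearPMap.isSelfAdjoint_of_surjective_add_one {A : E →ₗ.[ℂ] E}
    (hd : Dense (A.domain : Set E)) (hs : A.IsFormalAdjoint A)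
    (hsurj : ∀ ψ : E, ∃ ω : A.domain, (ω : E) + A ω = ψ) : IsSelfAdjoint A := by
  rw [LinearPMap.isSelfAdjoint_def]
  have hle : A ≤ A.adjoint := hs.le_adjoint hd
  have hfa := LinearPMap.adjoint_isFormalAdjoint hd
  refine (LinearPMap.eq_of_le_of_domain_eq hle (le_antisymm hle.1 fun y hy => ?_)).symm
  obtain ⟨ω, hω⟩ := hsurj (y + A.adjoint ⟨y, hy⟩)
  -- With `ω` chosen so that `(A + 1)ω = (A* + 1)y`, the difference `y - ω` is orthogonal to the
  -- range of `A + 1`, which is everything.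
  have h1 : ∀ x : A.domain, inner ℂ (y - ω) ((x : E) + A x) = 0 := by
    intro x
    have h2 := hfa ⟨y, hy⟩ x
    have h3 := hs ω x
    have h4 : (y - ω : E) = A ω - A.adjoint ⟨y, hy⟩ := by
      rw [sub_eq_sub_iff_add_eq_add, ← hω, add_comm]
    rw [inner_add_right]
    nth_rw 1 [h4]
    rw [inner_sub_left, inner_sub_left, h2, h3]
    ring
  obtain ⟨x, hx⟩ := hsurj (y - ω)
  have h5 := h1 x
  rw [hx, inner_self_eq_zero, sub_eq_zero] at h5
  rw [h5]
  exact ω.2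

/-- For a closed operator `T` on a domain `D`, the form `⟪η, ω⟫ + ⟪Tη, Tω⟫` represents all
functionals `⟪·, ψ⟫`. -/
lemma exists_form_add_inner_eq {D : Submodule ℂ E} (T : D →ₗ[ℂ] F)
    (hT : IsClosed {p : E × F | ∃ h : p.1 ∈ D, T ⟨p.1, h⟩ = p.2}) (ψ : E) :
    ∃ ω : D, ∀ η : D, inner ℂ (η : E) (ω : E) + inner ℂ (T η) (T ω) = inner ℂ (η : E) ψ := by
  -- The graph of `T` in the Hilbert sum. The first component of the projection of `(ψ, 0)` onto it
  -- is the required `ω`, and orthogonality of the remainder to the graph is the claimed identity.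
  let K : Submodule ℂ (WithLp 2 (E × F)) :=
    (LinearPMap.mk D T).graph.comap (WithLp.linearEquiv 2 ℂ (E × F)).toLinearMap
  have hmem : ∀ p : WithLp 2 (E × F), p ∈ K ↔ ∃ h : p.fst ∈ D, T ⟨p.fst, h⟩ = p.snd := by
    intro p
    constructor
    · intro hp
      obtain ⟨y, hy1, hy2⟩ := (LinearPMap.mem_graph_iff _).1 (Submodule.mem_comap.1 hp)
      have hy1' : (y : E) = p.fst := hy1
      refine ⟨hy1' ▸ y.2, ?_⟩
      have : (⟨p.fst, hy1' ▸ y.2⟩ : D) = y := Subtype.ext hy1'.symm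
      rw [this]
      exact hy2
    · rintro ⟨h, h'⟩
      exact Submodule.mem_comap.2 ((LinearPMap.mem_graph_iff _).2 ⟨⟨p.fst, h⟩, rfl, h'⟩)
  have hK : IsClosed (K : Set (WithLp 2 (E × F))) := by
    have h1 := hT.preimage (WithLp.prod_continuous_ofLp 2 E F)
    convert h1 using 1
    ext p
    exact hmem p
  have : CompleteSpace K := hK.completeSpace_coe
  obtain ⟨h, hp⟩ := (hmem _).1 (K.starProjection_apply_mem (WithLp.toLp 2 (ψ, (0 : F))))
  set p := K.starProjection (WithLp.toLp 2 (ψ, (0 : F))) with hpdef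
  refine ⟨⟨p.fst, h⟩, fun η => ?_⟩
  have hη : WithLp.toLp 2 ((η : E), T η) ∈ K := (hmem _).2 ⟨η.2, rfl⟩
  have h1 := K.starProjection_inner_eq_zero (WithLp.toLp 2 (ψ, (0 : F))) _ hη
  rw [← hpdef, inner_eq_zero_symm, WithLp.prod_inner_apply] at h1
  simp only [WithLp.ofLp_sub, Prod.fst_sub, Prod.snd_sub, inner_sub_right, zero_sub,
    inner_neg_right] at h1
  rw [hp]
  have h2 : inner ℂ (η : E) ψ - inner ℂ (η : E) p.fst + -inner ℂ (T η) p.snd = 0 := h1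
  linear_combination -h2

end Hilbert

/-! ### The Hodge Laplacian as a self-adjoint operator -/

namespace WeightedComplex

variable {X : Type*} {S : WeightedComplex X}

lemma sqSum_eq_norm_sq (f : S.L2) : S.sqSum f.1 = ENNReal.ofReal (‖f‖ ^ 2) := by
  have h0 : ∀ σ, 0 ≤ S.wt σ * ‖f.1 σ‖ ^ 2 := fun σ => mul_nonneg (S.wt_pos σ).le (sq_nonneg _)
  have h1 : S.IsL2 f.1 := f.2
  rw [sqSum, ← ENNReal.ofReal_tsum_of_nonneg h0 h1]
  congr 1
  have h2 : inner ℂ f f = ((∑' σ, S.wt σ * ‖f.1 σ‖ ^ 2 : ℝ) : ℂ) := by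
    rw [inner_def, Complex.ofReal_tsum]
    refine tsum_congr fun σ => ?_
    rw [mul_comm (conj _), Complex.mul_conj, Complex.normSq_eq_norm_sq]
    push_cast
    rfl
  rw [inner_self_eq_norm_sq_to_K] at h2
  exact Complex.ofReal_injective (by rw [Complex.ofReal_pow]; exact h2.symm)

lemma char_self (σ : S.Simplex) : S.char σ σ = 1 := by simp [char]

lemma char_of_ne {σ τ : S.Simplex} (h : τ ≠ σ) : S.char σ τ = 0 := by simp [char, h]

lemma support_char_subset (σ : S.Simplex) : Function.support (S.char σ) ⊆ {σ} := by
  intro τ hτ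
  by_contra h
  exact hτ (char_of_ne h)

lemma isL2_char (σ : S.Simplex) : S.IsL2 (S.char σ) := by
  refine summable_of_ne_finset_zero (s := {σ}) fun τ hτ => ?_
  rw [char_of_ne (by simpa using hτ)]
  simp

/-- The characteristic function of a simplex as an element of `ℓ²`. -/
def charL2 (σ : S.Simplex) : S.L2 := ⟨S.char σ, isL2_char σ⟩

lemma inner_charL2 (σ : S.Simplex) (f : S.L2) :
    inner ℂ (charL2 σ) f = (S.wt σ : ℂ) * f.1 σ := by
  rw [inner_def, tsum_eq_single σ]
  · simp [charL2, char_self]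
  · intro τ hτ
    simp [charL2, char_of_ne hτ]

lemma eq_zero_of_inner_charL2 {f : S.L2} (h : ∀ σ, inner ℂ (charL2 σ) f = 0) : f = 0 := by
  refine Subtype.ext (funext fun σ => ?_)
  have h1 := h σ
  rw [inner_charL2, mul_eq_zero] at h1
  exact h1.resolve_left (Complex.ofReal_ne_zero.2 (S.wt_pos σ).ne')

namespace Coboundary

variable (δ : S.Coboundary)

lemma hodgeForm_eq_norm_sq (ω : δ.neumannDomain) :
    δ.hodgeForm ω.1.1 = ENNReal.ofReal (‖δ.diracN ω‖ ^ 2) :=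
  sqSum_eq_norm_sq (δ.diracN ω)

lemma charL2_mem_dirichletDomain (σ : S.Simplex) : charL2 σ ∈ δ.dirichletDomain := by
  refine ⟨fun _ => charL2 σ, fun _ => (Set.finite_singleton σ).subset (support_char_subset σ), ?_⟩
  have h := δ.hodgeForm_eq_norm_sq 0
  rw [map_zero] at h
  have h2 : δ.hodgeForm (0 : S.L2).1 = 0 := by
    refine h.trans ?_
    simp
  simp only [sub_self, h2]
  simp

namespace ClosedForm

variable {δ} (Q : δ.ClosedForm)

lemma charL2_mem (σ : S.Simplex) : charL2 σ ∈ Q.domain :=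
  Q.dirichlet_subset (δ.charL2_mem_dirichletDomain σ)

lemma hodgeForm_eq (ω : Q.domain) : δ.hodgeForm ω.1.1 = ENNReal.ofReal (‖Q.diracQ ω‖ ^ 2) :=
  δ.hodgeForm_eq_norm_sq (Submodule.inclusion Q.le_neumann ω)

/-- Closedness of the form translated to its operator: along a convergent sequence in the graph the
images are Cauchy, and the form distance is the norm distance of the images. -/
lemma isClosed_graph_diracQ :
    IsClosed {p : S.L2 × S.L2 | ∃ h : p.1 ∈ Q.domain, Q.diracQ ⟨p.1, h⟩ = p.2} := by
  refine IsSeqClosed.isClosed ?_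
  rintro u ⟨ω, g⟩ hu hlim
  choose hu1 hu2 using hu
  have hl1 : Tendsto (fun n => (u n).1) atTop (𝓝 ω) := (continuous_fst.tendsto _).comp hlim
  have hl2 : Tendsto (fun n => (u n).2) atTop (𝓝 g) := (continuous_snd.tendsto _).comp hlim
  obtain ⟨h1, h2⟩ := Q.closed (fun n => (u n).1) ω hu1 hl1 (by
    intro ε hε
    -- The form is a squared norm, so the radius is the square root of `ε`; any positive radius
    -- serves when `ε = ∞`.
    obtain ⟨r, hr0, hr⟩ : ∃ r : ℝ, 0 < r ∧ ENNReal.ofReal (r ^ 2) ≤ ε := by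
      rcases eq_or_ne ε ∞ with h | h
      · exact ⟨1, one_pos, h ▸ le_top⟩
      · refine ⟨Real.sqrt ε.toReal, Real.sqrt_pos.2 (ENNReal.toReal_pos hε.ne' h), ?_⟩
        rw [Real.sq_sqrt ENNReal.toReal_nonneg, ENNReal.ofReal_toReal h]
    obtain ⟨N, hN⟩ := Metric.cauchySeq_iff.1 hl2.cauchySeq r hr0
    refine ⟨N, fun j hj k hk => lt_of_lt_of_le ?_ hr⟩
    have h3 := Q.hodgeForm_eq (⟨(u j).1, hu1 j⟩ - ⟨(u k).1, hu1 k⟩)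
    rw [map_sub, hu2, hu2, ← dist_eq_norm] at h3
    refine h3.trans_lt ?_
    rw [ENNReal.ofReal_lt_ofReal_iff (by positivity)]
    exact pow_lt_pow_left₀ (hN j hj k hk) dist_nonneg two_ne_zero)
  refine ⟨h1, ?_⟩
  have h3 : Tendsto (fun n => ‖(u n).2 - Q.diracQ ⟨ω, h1⟩‖ ^ 2) atTop (𝓝 0) := by
    have h4 := (ENNReal.tendsto_toReal ENNReal.zero_ne_top).comp h2
    refine h4.congr fun n => ?_
    have h5 := Q.hodgeForm_eq (⟨(u n).1, hu1 n⟩ - ⟨ω, h1⟩)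
    rw [map_sub, hu2] at h5
    refine (congrArg ENNReal.toReal h5).trans ?_
    rw [ENNReal.toReal_ofReal (sq_nonneg _)]
  have h6 : Tendsto (fun n => ‖(u n).2 - Q.diracQ ⟨ω, h1⟩‖) atTop (𝓝 0) := by
    have := (Real.continuous_sqrt.tendsto _).comp h3
    simpa [Function.comp_def, Real.sqrt_sq (norm_nonneg _)] using this
  exact tendsto_nhds_unique (tendsto_iff_norm_sub_tendsto_zero.2 h6) hl2

/-- Single-valuedness, needed to turn the relation into an operator; it suffices to test with
characteristic functions. -/
lemma laplacianGraph_snd_eq_zero (p : S.L2 × S.L2) (hp : p ∈ Q.laplacianGraph) (h0 : p.1 = 0) :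
    p.2 = 0 := by
  obtain ⟨h, h'⟩ := hp
  refine eq_zero_of_inner_charL2 fun σ => ?_
  have h1 : (⟨p.1, h⟩ : Q.domain) = 0 := Subtype.ext h0
  have h2 := h' ⟨charL2 σ, Q.charL2_mem σ⟩
  rw [h1, form, map_zero, inner_zero_right] at h2
  exact h2.symm

lemma hodgeLaplacian_spec (ω : Q.hodgeLaplacian.domain) :
    ∃ hω : (ω : S.L2) ∈ Q.domain, ∀ η : Q.domain,
      Q.form ⟨ω, hω⟩ η = inner ℂ (η : S.L2) (Q.hodgeLaplacian ω) :=
  Submodule.mem_graph_toLinearPMap Q.laplacianGraph_snd_eq_zero ω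

lemma exists_hodgeLaplacian_eq {p : S.L2 × S.L2} (hp : p ∈ Q.laplacianGraph) :
    ∃ ω : Q.hodgeLaplacian.domain, (ω : S.L2) = p.1 ∧ Q.hodgeLaplacian ω = p.2 := by
  rw [← Submodule.toLinearPMap_graph_eq _ Q.laplacianGraph_snd_eq_zero] at hp
  exact (LinearPMap.mem_graph_iff _).1 hp

lemma exists_resolvent (ψ : S.L2) :
    ∃ ω : Q.hodgeLaplacian.domain, (ω : S.L2) + Q.hodgeLaplacian ω = ψ := by
  obtain ⟨ω, hω⟩ := exists_form_add_inner_eq Q.diracQ Q.isClosed_graph_diracQ ψ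
  obtain ⟨ω', h1, h2⟩ := Q.exists_hodgeLaplacian_eq (p := ((ω : S.L2), ψ - ω))
    ⟨ω.2, fun η => by
      rw [inner_sub_right, ← hω η, form]
      simp⟩
  exact ⟨ω', by rw [h1, h2]; simp⟩

/-- If `h` is orthogonal to the domain, write `h = ω + Δ^H ω`. Pairing with `ω` gives `‖ω‖² + ‖(δ +
∂)ω‖² = 0`, so `ω = 0` and `h = 0`. -/
lemma dense_domain_hodgeLaplacian : Dense (Q.hodgeLaplacian.domain : Set S.L2) := by
  rw [Submodule.dense_iff_topologicalClosure_eq_top, Submodule.topologicalClosure_eq_top_iff,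
    Submodule.eq_bot_iff]
  intro h hh
  obtain ⟨ω, hω⟩ := Q.exists_resolvent h
  obtain ⟨hd, hform⟩ := Q.hodgeLaplacian_spec ω
  have h1 : inner ℂ (ω : S.L2) h = 0 := (Submodule.mem_orthogonal _ _).1 hh ω ω.2
  rw [← hω, inner_add_right, ← hform ⟨ω, hd⟩, form, inner_self_eq_norm_sq_to_K,
    inner_self_eq_norm_sq_to_K] at h1
  have h2 : ‖(ω : S.L2)‖ ^ 2 + ‖Q.diracQ ⟨ω, hd⟩‖ ^ 2 = 0 :=
    Complex.ofReal_injective (by push_cast; exact h1)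
  have h3 : ‖(ω : S.L2)‖ = 0 := by
    nlinarith [sq_nonneg ‖(ω : S.L2)‖, sq_nonneg ‖Q.diracQ ⟨ω, hd⟩‖]
  have h4 : ω = 0 := Subtype.ext (norm_eq_zero.1 h3)
  rw [← hω, h4, LinearPMap.map_zero]
  simp

theorem isSelfAdjoint_hodgeLaplacian : IsSelfAdjoint Q.hodgeLaplacian := by
  refine LinearPMap.isSelfAdjoint_of_surjective_add_one Q.dense_domain_hodgeLaplacian ?_
    Q.exists_resolvent
  intro ω η
  obtain ⟨hω, hω'⟩ := Q.hodgeLaplacian_spec ω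
  obtain ⟨hη, hη'⟩ := Q.hodgeLaplacian_spec η
  rw [← hη' ⟨ω, hω⟩, ← inner_conj_symm, ← hω' ⟨η, hη⟩, form, form, inner_conj_symm]

end ClosedForm

end Coboundary

end WeightedComplex

/-! ### Signs of the coboundary operator and the domain of `∂` -/

namespace WeightedComplex

variable {X : Type*} {S : WeightedComplex X}

lemma mem_facesOf {τ σ : S.Simplex} : τ ∈ S.facesOf σ ↔ IsFace τ.1 σ.1 := by
  simp [facesOf]

lemma mem_simplices_of_nonempty {σ : Finset X} (h : σ ∈ S.faces) (hn : σ.Nonempty) :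
    σ ∈ S.simplices := ⟨h, fun h0 => absurd h0 hn.ne_empty⟩

/-- Two different faces of a simplex span it. -/
lemma IsFace.eq_of_ne {ρ ρ' τ τ' : Finset X} (h1 : IsFace ρ τ) (h2 : IsFace ρ' τ)
    (h1' : IsFace ρ τ') (h2' : IsFace ρ' τ') (hne : ρ' ≠ ρ) : τ' = τ := by
  classical
  have key : ∀ κ : Finset X, IsFace ρ κ → IsFace ρ' κ → ρ ∪ ρ' = κ := by
    intro κ h h'
    refine Finset.eq_of_subset_of_card_le (Finset.union_subset h.1 h'.1) ?_
    rw [h.2]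
    refine Finset.card_lt_card (Finset.ssubset_iff_subset_ne.2 ⟨Finset.subset_union_left, ?_⟩)
    intro h3
    have h4 : ρ' ⊆ ρ := h3 ▸ Finset.subset_union_right
    have h5 := h.2
    have h6 := h'.2
    exact hne (Finset.eq_of_subset_of_card_le h4 (by omega))
  rw [← key τ h1 h2, ← key τ' h1' h2']

namespace Coboundary

variable (δ : S.Coboundary)

lemma theta_eq_zero {τ σ : S.Simplex} (h : ¬IsFace τ.1 σ.1) : δ.theta τ σ = 0 := by
  by_contra h1
  exact h ((δ.ne_zero_iff τ σ).1 h1)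

lemma theta_eq_one_or {τ σ : S.Simplex} (h : IsFace τ.1 σ.1) :
    δ.theta τ σ = 1 ∨ δ.theta τ σ = -1 := by
  have h1 : δ.theta τ σ ∈ ({1, -1, 0} : Set ℂ) := δ.sign τ σ
  have h2 : δ.theta τ σ ≠ 0 := (δ.ne_zero_iff τ σ).2 h
  simp only [Set.mem_insert_iff, Set.mem_singleton_iff] at h1
  tauto

lemma norm_theta {τ σ : S.Simplex} (h : IsFace τ.1 σ.1) : ‖δ.theta τ σ‖ = 1 := by
  rcases δ.theta_eq_one_or h with h | h <;> simp [h]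

lemma conj_theta (τ σ : S.Simplex) : conj (δ.theta τ σ) = δ.theta τ σ := by
  by_cases h : IsFace τ.1 σ.1
  · rcases δ.theta_eq_one_or h with h | h <;> simp [h]
  · simp [δ.theta_eq_zero h]

lemma toLin_apply (ω : S.Simplex → ℂ) (σ : S.Simplex) :
    δ.toLin ω σ = ∑ τ ∈ S.facesOf σ, δ.theta τ σ * ω τ := δ.apply_eq ω σ

/-- `δδ = 0` in terms of signs: the two ways from `ρ` to a simplex of two dimensions more cancel. -/
lemma theta_mul_add_theta_mul {ρ τ τ' σ : S.Simplex} (h1 : IsFace ρ.1 τ.1) (h1' : IsFace ρ.1 τ'.1)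
    (h2 : IsFace τ.1 σ.1) (h2' : IsFace τ'.1 σ.1) (hne : τ ≠ τ') :
    δ.theta ρ τ * δ.theta τ σ + δ.theta ρ τ' * δ.theta τ' σ = 0 := by
  classical
  have h := congrFun (δ.sq_zero (S.char ρ)) σ
  rw [toLin_apply] at h
  have hsub : ({τ, τ'} : Finset S.Simplex) ⊆ S.facesOf σ := by
    intro κ hκ
    rcases Finset.mem_insert.1 hκ with rfl | hκ
    · exact mem_facesOf.2 h2
    · rw [Finset.mem_singleton.1 hκ]
      exact mem_facesOf.2 h2'
  rw [← Finset.sum_subset hsub, Finset.sum_pair hne] at h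
  · rw [← h.trans (Pi.zero_apply _)]
    change δ.theta ρ τ * δ.theta τ σ + δ.theta ρ τ' * δ.theta τ' σ =
      δ.theta τ σ * δ.theta ρ τ + δ.theta τ' σ * δ.theta ρ τ'
    ring
  · intro κ hκ hκ'
    have hκσ := mem_facesOf.1 hκ
    refine mul_eq_zero_of_right _ (δ.theta_eq_zero fun hρκ => hκ' ?_)
    have hττ : τ.1 ≠ τ'.1 := fun h => hne (Subtype.ext h)
    -- all three faces contain `ρ`, and `σ` has only two vertices outside `ρ`
    obtain ⟨v, hv, hvτ⟩ := Finset.exists_eq_insert_iff.2 ⟨h1.1, h1.2.symm⟩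
    obtain ⟨w, hw, hwτ⟩ := Finset.exists_eq_insert_iff.2 ⟨h1'.1, h1'.2.symm⟩
    obtain ⟨x, hx, hxκ⟩ := Finset.exists_eq_insert_iff.2 ⟨hρκ.1, hρκ.2.symm⟩
    by_contra hcon
    have hne1 : κ ≠ τ := fun h => hcon (by simp [h])
    have hne2 : κ ≠ τ' := fun h => hcon (by simp [h])
    have hvw : v ≠ w := fun h => hττ (by rw [← hvτ, ← hwτ, h])
    have hxv : x ≠ v := fun h => hne1 (Subtype.ext (by rw [← hvτ, ← hxκ, h]))
    have hxw : x ≠ w := fun h => hne2 (Subtype.ext (by rw [← hwτ, ← hxκ, h]))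
    have hsub3 : insert x (insert v (insert w ρ.1)) ⊆ σ.1 := by
      intro y hy
      rcases Finset.mem_insert.1 hy with rfl | hy
      · exact hκσ.1 (hxκ ▸ Finset.mem_insert_self _ _)
      rcases Finset.mem_insert.1 hy with rfl | hy
      · exact h2.1 (hvτ ▸ Finset.mem_insert_self _ _)
      exact h2'.1 (hwτ ▸ hy)
    have hcard := Finset.card_le_card hsub3
    rw [Finset.card_insert_of_notMem (by simp [hxv, hxw, hx]),
      Finset.card_insert_of_notMem (by simp [hvw, hv]), Finset.card_insert_of_notMem hw,
      h2.2, h1.2] at hcard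
    omega

/-- If `∂δ` maps finitely supported functions to `ℓ²`, then `δ` maps `ℓ²` to `D(∂)`. -/
theorem toLin_mem_boundaryDomain
    (hδ : ∀ φ : S.Simplex → ℂ, (Function.support φ).Finite → S.IsL2 (δ.boundary (δ.toLin φ)))
    {ω : S.Simplex → ℂ} (hω : S.IsL2 ω) : δ.toLin ω ∈ S.boundaryDomain := by
  classical
  intro ρ
  set h := δ.boundary (δ.toLin (S.char ρ)) with hh
  have hL2 : S.IsL2 h := hδ _ ((Set.finite_singleton ρ).subset (support_char_subset ρ))
  -- Two different faces have at most one common coface, so the series for `∂δ1_ρ(ρ')` has a single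
  -- nonzero term. Thus `|h(ρ')|` is exactly `m(τ)/m(ρ')`.
  have hm : ∀ (ρ' τ : S.Simplex), IsFace ρ.1 τ.1 → IsFace ρ'.1 τ.1 → ρ' ≠ ρ →
      S.wt τ = S.wt ρ' * ‖h ρ'‖ := by
    intro ρ' τ h1 h2 hne
    have h3 : ∑' κ : S.Coface ρ', (S.wt κ.1 : ℂ) * δ.theta ρ' κ.1 * δ.toLin (S.char ρ) κ.1 =
        (S.wt τ : ℂ) * δ.theta ρ' τ * δ.theta ρ τ := by
      refine tsum_eq_single (⟨τ, h2⟩ : S.Coface ρ') fun κ hκ => ?_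
      refine mul_eq_zero_of_right _ (δ.theta_eq_zero fun h4 => hκ ?_)
      exact Subtype.ext (Subtype.ext
        (IsFace.eq_of_ne h1 h2 h4 κ.2 fun h5 => hne (Subtype.ext h5)))
    rw [hh, boundary, h3, norm_mul, norm_mul, norm_mul, δ.norm_theta h1, δ.norm_theta h2,
      norm_inv, Complex.norm_real, Complex.norm_real, Real.norm_eq_abs, Real.norm_eq_abs,
      abs_of_pos (S.wt_pos _), abs_of_pos (S.wt_pos _), mul_one, mul_one,
      mul_inv_cancel_left₀ (S.wt_pos ρ').ne']
  have hg : Summable fun ρ' : S.Simplex => S.wt ρ' * ‖h ρ'‖ * ‖ω ρ'‖ := by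
    refine Summable.of_nonneg_of_le (fun ρ' => ?_) (fun ρ' => ?_)
      ((show Summable fun σ => S.wt σ * ‖h σ‖ ^ 2 from hL2).add
        (show Summable fun σ => S.wt σ * ‖ω σ‖ ^ 2 from hω))
    · have := (S.wt_pos ρ').le
      positivity
    · rw [mul_assoc, ← mul_add]
      refine mul_le_mul_of_nonneg_left ?_ (S.wt_pos ρ').le
      nlinarith [sq_nonneg (‖h ρ'‖ - ‖ω ρ'‖), sq_nonneg ‖h ρ'‖, sq_nonneg ‖ω ρ'‖]
  -- Again `τ` is determined by `ρ` and `ρ'`, so the pairs `(τ, ρ')` inject into the simplices `ρ'`.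
  -- The excluded case `ρ' = ρ` is handled by local summability of `m`.
  have hP : Summable fun p : Σ τ : S.Coface ρ, {ρ' // ρ' ∈ (S.facesOf τ.1).erase ρ} =>
      S.wt p.1.1 * ‖ω p.2.1‖ := by
    have hinj : Function.Injective fun p : Σ τ : S.Coface ρ,
        {ρ' // ρ' ∈ (S.facesOf τ.1).erase ρ} => p.2.1 := by
      rintro ⟨τ, ρ₁, h₁⟩ ⟨τ', ρ₂, h₂⟩ heq
      obtain rfl : ρ₁ = ρ₂ := heq
      obtain ⟨h3, h4⟩ := Finset.mem_erase.1 h₁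
      obtain ⟨-, h6⟩ := Finset.mem_erase.1 h₂
      obtain rfl : τ' = τ := Subtype.ext (Subtype.ext
        (IsFace.eq_of_ne τ.2 (mem_facesOf.1 h4) τ'.2 (mem_facesOf.1 h6)
          fun h5 => h3 (Subtype.ext h5)))
      rfl
    refine (hg.comp_injective hinj).congr fun p => ?_
    obtain ⟨h3, h4⟩ := Finset.mem_erase.1 p.2.2
    simp only [Function.comp_apply]
    rw [hm _ _ p.1.2 (mem_facesOf.1 h4) h3]
  refine Summable.of_nonneg_of_le (fun τ => mul_nonneg (S.wt_pos _).le (norm_nonneg _))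
    (fun τ => ?_) (((S.summable_coface ρ).mul_right ‖ω ρ‖).add hP.sigma)
  have h1 : ∑' ρ' : {ρ' // ρ' ∈ (S.facesOf τ.1).erase ρ}, S.wt τ.1 * ‖ω ρ'.1‖ =
      ∑ ρ' ∈ (S.facesOf τ.1).erase ρ, S.wt τ.1 * ‖ω ρ'‖ :=
    Finset.tsum_subtype ((S.facesOf τ.1).erase ρ) fun ρ' => S.wt τ.1 * ‖ω ρ'‖
  simp only
  rw [h1, Finset.add_sum_erase _ (fun ρ' => S.wt τ.1 * ‖ω ρ'‖) (mem_facesOf.2 τ.2),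
    ← Finset.mul_sum]
  refine mul_le_mul_of_nonneg_left ?_ (S.wt_pos _).le
  rw [toLin_apply]
  refine norm_sum_le_of_le _ fun ρ' _ => ?_
  rw [norm_mul]
  exact mul_le_of_le_one_left (norm_nonneg _) (δ.norm_theta_le _ _)

/-! ### The Hodge Laplacian acts as `(δ + ∂)²` -/

lemma boundary_char (σ ρ : S.Simplex) :
    δ.boundary (S.char σ) ρ = (S.wt ρ : ℂ)⁻¹ * ((S.wt σ : ℂ) * δ.theta ρ σ) := by
  rw [boundary]
  congr 1
  by_cases h : IsFace ρ.1 σ.1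
  · rw [tsum_eq_single (⟨σ, h⟩ : S.Coface ρ)]
    · rw [char_self, mul_one]
    · intro κ hκ
      rw [char_of_ne fun h1 => hκ (Subtype.ext h1), mul_zero]
  · rw [δ.theta_eq_zero h, mul_zero]
    refine (tsum_congr fun κ => ?_).trans tsum_zero
    rw [char_of_ne fun h1 : κ.1 = σ => h (h1 ▸ κ.2), mul_zero]

/-- `δ + ∂` is formally symmetric. -/
lemma tsum_dirac_char_mul (σ : S.Simplex) {g : S.Simplex → ℂ} (hg : g ∈ S.boundaryDomain) :
    ∑' τ, (S.wt τ : ℂ) * (conj (δ.dirac (S.char σ) τ) * g τ) =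
      (S.wt σ : ℂ) * δ.dirac g σ := by
  have hw : ∀ τ : S.Simplex, (S.wt τ : ℂ) ≠ 0 := fun τ =>
    Complex.ofReal_ne_zero.2 (S.wt_pos τ).ne'
  -- The first term lives on cofaces of `σ` and yields `∂g(σ)`; the second lives on the finitely
  -- many faces and yields `δg(σ)`.
  have hsplit : ∀ τ, (S.wt τ : ℂ) * (conj (δ.dirac (S.char σ) τ) * g τ) =
      (S.wt τ : ℂ) * δ.theta σ τ * g τ + (S.wt σ : ℂ) * (δ.theta τ σ * g τ) := by
    intro τ
    have h1 : δ.dirac (S.char σ) τ =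
        δ.theta σ τ + (S.wt τ : ℂ)⁻¹ * ((S.wt σ : ℂ) * δ.theta τ σ) := by
      rw [← boundary_char]
      rfl
    rw [h1, map_add, map_mul, map_mul, map_inv₀, conj_theta, conj_theta, Complex.conj_ofReal,
      Complex.conj_ofReal]
    field_simp [hw τ]
  have hsupp : Function.support (fun τ => (S.wt τ : ℂ) * δ.theta σ τ * g τ) ⊆
      {τ | IsFace σ.1 τ.1} := by
    intro τ hτ
    by_contra h
    refine hτ ?_
    simp only
    rw [δ.theta_eq_zero h]
    ring
  have hs1 : Summable fun τ => (S.wt τ : ℂ) * δ.theta σ τ * g τ := by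
    have h1 := summable_subtype_iff_indicator.1
      (show Summable ((fun τ => (S.wt τ : ℂ) * δ.theta σ τ * g τ) ∘
        (Subtype.val : {τ : S.Simplex | IsFace σ.1 τ.1} → S.Simplex)) from
        δ.summable_boundary hg σ)
    rwa [Set.indicator_eq_self.2 hsupp] at h1
  have hzero : ∀ τ ∉ S.facesOf σ, (S.wt σ : ℂ) * (δ.theta τ σ * g τ) = 0 := by
    intro τ hτ
    rw [δ.theta_eq_zero fun h => hτ (mem_facesOf.2 h)]
    ring
  rw [tsum_congr hsplit, hs1.tsum_add (summable_of_ne_finset_zero hzero), tsum_eq_sum hzero,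
    ← Finset.mul_sum, ← toLin_apply, ← tsum_subtype_eq_of_support_subset hsupp, dirac,
    Pi.add_apply, boundary, mul_add, mul_inv_cancel_left₀ (hw σ), add_comm]
  rfl

/-- Test the form with `1_σ` and move `δ + ∂` to the other side, which is legitimate because `(δ +
∂)ω ∈ ℓ² ⊆ D(∂)`. Neither recurrence nor the condition on `∂δ` enters here. -/
lemma ClosedForm.hodgeLaplacian_eq_dirac_dirac {δ : S.Coboundary} (Q : δ.ClosedForm)
    (ω : Q.hodgeLaplacian.domain) :
    S.IsL2 (δ.dirac ω.1.1) ∧ (Q.hodgeLaplacian ω).1 = δ.dirac (δ.dirac ω.1.1) := by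
  obtain ⟨hω, h⟩ := Q.hodgeLaplacian_spec ω
  have hg : S.IsL2 (δ.dirac ω.1.1) := (Q.diracQ ⟨ω, hω⟩).2
  refine ⟨hg, funext fun σ => ?_⟩
  have h1 := h ⟨charL2 σ, Q.charL2_mem σ⟩
  have h2 := δ.tsum_dirac_char_mul σ (IsL2.mem_boundaryDomain S hg)
  rw [inner_charL2] at h1
  exact mul_left_cancel₀ (Complex.ofReal_ne_zero.2 (S.wt_pos σ).ne') (h1.symm.trans h2)

/-! ### Degrees -/

lemma dim_of_isFace {τ σ : S.Simplex} (h : IsFace τ.1 σ.1) : S.dim σ = S.dim τ + 1 := by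
  have := h.2
  simp only [dim]
  omega

lemma toLin_degreePart (k : ℤ) (ω : S.Simplex → ℂ) :
    δ.toLin (S.degreePart k ω) = S.degreePart (k + 1) (δ.toLin ω) := by
  funext σ
  rw [degreePart, toLin_apply, toLin_apply]
  split_ifs with h
  · refine Finset.sum_congr rfl fun τ hτ => ?_
    have := dim_of_isFace (mem_facesOf.1 hτ)
    rw [degreePart, if_pos (by omega)]
  · refine Finset.sum_eq_zero fun τ hτ => ?_
    have := dim_of_isFace (mem_facesOf.1 hτ)
    rw [degreePart, if_neg (by omega), mul_zero]

lemma boundary_degreePart (k : ℤ) (ω : S.Simplex → ℂ) :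
    δ.boundary (S.degreePart (k + 1) ω) = S.degreePart k (δ.boundary ω) := by
  funext ρ
  rw [degreePart, boundary, boundary]
  split_ifs with h
  · congr 1
    refine tsum_congr fun τ => ?_
    have := dim_of_isFace τ.2
    rw [degreePart, if_pos (by omega)]
  · refine mul_eq_zero_of_right _ ((tsum_congr fun τ => ?_).trans tsum_zero)
    have := dim_of_isFace τ.2
    rw [degreePart, if_neg (by omega), mul_zero]

lemma isL2_degreePart (k : ℤ) {ω : S.Simplex → ℂ} (hω : S.IsL2 ω) :
    S.IsL2 (S.degreePart k ω) := by
  refine Summable.of_nonneg_of_le (fun σ => mul_nonneg (S.wt_pos _).le (sq_nonneg _))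
    (fun σ => ?_) hω
  refine mul_le_mul_of_nonneg_left ?_ (S.wt_pos _).le
  rw [degreePart]
  split_ifs
  · exact le_rfl
  · simp

lemma degreePart_add (k : ℤ) (ω η : S.Simplex → ℂ) :
    S.degreePart k (ω + η) = S.degreePart k ω + S.degreePart k η := by
  funext σ
  simp only [degreePart, Pi.add_apply]
  split_ifs <;> simp

end Coboundary

end WeightedComplex

namespace WeightedComplex

variable {X : Type*} {S : WeightedComplex X}

/-! ### Links and cofaces -/

section Link

open Classical in
/-- The coface `ρ ∪ {v}` of `ρ` for `v` in the link of `ρ`. -/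
def linkCoface (ρ : S.Simplex) (v : S.link ρ) : S.Coface ρ := ⟨⟨insert v.1 ρ.1, v.2.1⟩, v.2.2⟩

open Classical in
lemma linkCoface_coe (ρ : S.Simplex) (v : S.link ρ) :
    (linkCoface ρ v).1.1 = insert v.1 ρ.1 := rfl

lemma bijective_linkCoface (ρ : S.Simplex) : Function.Bijective (linkCoface ρ) := by
  classical
  constructor
  · intro v w h
    have h1 : insert v.1 ρ.1 = insert w.1 ρ.1 := by
      have h2 := congrArg (fun τ : S.Coface ρ => τ.1.1) h
      simpa only [linkCoface_coe] using h2
    have h3 : v.1 ∈ insert w.1 ρ.1 := h1 ▸ Finset.mem_insert_self _ _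
    rcases Finset.mem_insert.1 h3 with h4 | h4
    · exact Subtype.ext h4
    · exact absurd h4 (S.notMem_of_mem_link v.2)
  · rintro ⟨⟨τ, hτ⟩, hρτ⟩
    obtain ⟨v, hv, rfl⟩ := Finset.exists_eq_insert_iff.2 ⟨hρτ.1, hρτ.2.symm⟩
    have hv : v ∈ S.link ρ := by
      unfold link
      refine ⟨?_, ?_⟩
      · convert hτ
      · convert hρτ
    refine ⟨⟨v, hv⟩, Subtype.ext (Subtype.ext ?_)⟩
    rw [linkCoface_coe]

/-- The vertices of the link of `ρ` correspond to the cofaces of `ρ`. -/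
def linkEquiv (ρ : S.Simplex) : S.link ρ ≃ S.Coface ρ :=
  Equiv.ofBijective (linkCoface ρ) (bijective_linkCoface ρ)

open Classical in
/-- The edges of the link of `ρ`. -/
def LinkAdj (ρ : S.Simplex) (v w : S.link ρ) : Prop :=
  v ≠ w ∧ insert v.1 (insert w.1 ρ.1) ∈ S.faces

lemma LinkAdj.symm {ρ : S.Simplex} {v w : S.link ρ} (h : LinkAdj ρ v w) : LinkAdj ρ w v := by
  classical
  refine ⟨h.1.symm, ?_⟩
  have h2 := h.2
  rwa [Finset.insert_comm] at h2

open Classical in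
/-- The simplex `ρ ∪ {v, w}` for an edge `(v, w)` of the link of `ρ`. -/
def linkSimplex (ρ : S.Simplex) (v w : S.link ρ) (h : LinkAdj ρ v w) : S.Simplex :=
  ⟨insert v.1 (insert w.1 ρ.1), mem_simplices_of_nonempty h.2 (Finset.insert_nonempty _ _)⟩

lemma linkSimplex_symm (ρ : S.Simplex) (v w : S.link ρ) (h : LinkAdj ρ v w) :
    linkSimplex ρ w v h.symm = linkSimplex ρ v w h := by
  classical
  refine Subtype.ext ?_
  simp only [linkSimplex]
  rw [Finset.insert_comm]

lemma isFace_linkSimplex (ρ : S.Simplex) (v w : S.link ρ) (h : LinkAdj ρ v w) :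
    IsFace (linkCoface ρ v).1.1 (linkSimplex ρ v w h).1 := by
  classical
  simp only [linkSimplex, linkCoface_coe]
  rw [Finset.insert_comm]
  refine ⟨Finset.subset_insert _ _, Finset.card_insert_of_notMem fun hmem => ?_⟩
  rcases Finset.mem_insert.1 hmem with h1 | h1
  · exact h.1 (Subtype.ext h1.symm)
  · exact S.notMem_of_mem_link w.2 h1

lemma linkWeight_of_adj {ρ : S.Simplex} {v w : S.link ρ} (h : LinkAdj ρ v w) :
    (S.linkGraph ρ).b v w = S.wt (linkSimplex ρ v w h) := by
  classical
  change S.linkWeight ρ v w = _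
  unfold linkWeight
  exact if_pos h

lemma linkWeight_of_not_adj {ρ : S.Simplex} {v w : S.link ρ} (h : ¬LinkAdj ρ v w) :
    (S.linkGraph ρ).b v w = 0 := by
  classical
  change S.linkWeight ρ v w = _
  unfold linkWeight
  exact if_neg h

lemma linkSimplex_injective_right {ρ : S.Simplex} {v w w' : S.link ρ} (h : LinkAdj ρ v w)
    (h' : LinkAdj ρ v w') (heq : linkSimplex ρ v w h = linkSimplex ρ v w' h') : w = w' := by
  classical
  have h2 : insert v.1 (insert w.1 ρ.1) = insert v.1 (insert w'.1 ρ.1) := by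
    have h1 := congrArg (fun z : S.Simplex => z.1) heq
    simpa only [linkSimplex] using h1
  have h3 : w.1 ∈ insert v.1 (insert w'.1 ρ.1) := by
    rw [← h2]
    simp
  rcases Finset.mem_insert.1 h3 with h4 | h4
  · exact absurd (Subtype.ext h4.symm) h.1
  · rcases Finset.mem_insert.1 h4 with h5 | h5
    · exact Subtype.ext h5
    · exact absurd h5 (S.notMem_of_mem_link w.2)

/-- Neighbours of `v` in the link of `ρ` are cofaces of `ρ ∪ {v}`; closure under subsets ensures
that the added vertex lies in the link. -/
lemma bijective_linkSimplex (ρ : S.Simplex) (v : S.link ρ) :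
    Function.Bijective fun w : {w : S.link ρ // LinkAdj ρ v w} =>
      (⟨linkSimplex ρ v w.1 w.2, isFace_linkSimplex ρ v w.1 w.2⟩ :
        S.Coface (linkCoface ρ v).1) := by
  classical
  constructor
  · intro w w' h
    exact Subtype.ext (linkSimplex_injective_right w.2 w'.2 (congrArg Subtype.val h))
  · rintro ⟨⟨σ, hσ⟩, hf⟩
    have hf' : IsFace (insert v.1 ρ.1) σ := by
      have := hf
      simp only [linkCoface_coe] at this
      convert this
    obtain ⟨w, hw, hwσ⟩ := Finset.exists_eq_insert_iff.2 ⟨hf'.1, hf'.2.symm⟩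
    have hwv : w ≠ v.1 := fun h => hw (by simp [h])
    have hwρ : w ∉ ρ.1 := fun h => hw (by simp [h])
    have hface : insert w ρ.1 ∈ S.faces := by
      refine S.down_closed σ hσ.1 _ ?_
      rw [← hwσ]
      exact Finset.insert_subset_insert _ (Finset.subset_insert _ _)
    have hwl : w ∈ S.link ρ := by
      unfold link
      refine ⟨?_, ?_⟩
      · convert mem_simplices_of_nonempty hface (Finset.insert_nonempty _ _)
      · refine ⟨?_, ?_⟩
        · convert Finset.subset_insert w ρ.1
        · convert Finset.card_insert_of_notMem hwρ
    have hadj : LinkAdj ρ v ⟨w, hwl⟩ := by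
      refine ⟨fun h => hwv (congrArg Subtype.val h).symm, ?_⟩
      convert hσ.1
      rw [← hwσ, Finset.insert_comm]
    refine ⟨⟨⟨w, hwl⟩, hadj⟩, Subtype.ext (Subtype.ext ?_)⟩
    simp only [linkSimplex]
    rw [← hwσ, Finset.insert_comm]

/-- An `ℓ²`-function is square summable over the pairs of adjacent vertices of a link. -/
lemma summable_linkSimplex (ρ : S.Simplex) {ω : S.Simplex → ℂ} (hω : S.IsL2 ω) :
    Summable fun p : {p : S.link ρ × S.link ρ // LinkAdj ρ p.1 p.2} =>
      S.wt (linkSimplex ρ p.1.1 p.1.2 p.2) * ‖ω (linkSimplex ρ p.1.1 p.1.2 p.2)‖ ^ 2 := by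
  classical
  -- Each ordered edge `(v, w)` is recorded by its simplex `ρ ∪ {v, w}` together with the vertex
  -- `v`. A simplex with `N` vertices is thus counted at most `N` times.
  let N := ρ.1.card + 2
  have hs : Summable fun q : Σ σ : {σ : S.Simplex // σ.1.card = N}, {x // x ∈ σ.1.1} =>
      S.wt q.1.1 * ‖ω q.1.1‖ ^ 2 := by
    have h0 : ∀ q : Σ σ : {σ : S.Simplex // σ.1.card = N}, {x // x ∈ σ.1.1},
        0 ≤ S.wt q.1.1 * ‖ω q.1.1‖ ^ 2 := fun q => mul_nonneg (S.wt_pos _).le (sq_nonneg _)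
    refine (summable_sigma_of_nonneg h0).2 ⟨fun σ => Summable.of_finite, ?_⟩
    have h1 : Summable fun σ : {σ : S.Simplex // σ.1.card = N} =>
        (N : ℝ) * (S.wt σ.1 * ‖ω σ.1‖ ^ 2) :=
      (Summable.comp_injective (i := Subtype.val)
        (show Summable fun σ => S.wt σ * ‖ω σ‖ ^ 2 from hω) Subtype.val_injective).mul_left _
    refine h1.congr fun σ => ?_
    have h2 : ∑' x : {x // x ∈ σ.1.1}, S.wt σ.1 * ‖ω σ.1‖ ^ 2 = N * (S.wt σ.1 * ‖ω σ.1‖ ^ 2) := by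
      rw [tsum_fintype, Finset.sum_const, nsmul_eq_mul, Finset.card_univ, Fintype.card_coe, σ.2]
    exact h2.symm
  have hcard : ∀ p : {p : S.link ρ × S.link ρ // LinkAdj ρ p.1 p.2},
      (linkSimplex ρ p.1.1 p.1.2 p.2).1.card = N := by
    intro p
    have h1 := (isFace_linkSimplex ρ p.1.1 p.1.2 p.2).2
    have h2 := (linkCoface ρ p.1.1).2.2
    rw [h1, h2]
  have hmem : ∀ p : {p : S.link ρ × S.link ρ // LinkAdj ρ p.1 p.2},
      p.1.1.1 ∈ (linkSimplex ρ p.1.1 p.1.2 p.2).1 := fun p => by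
    simp only [linkSimplex]
    exact Finset.mem_insert_self _ _
  refine Summable.comp_injective (i := fun p : {p : S.link ρ × S.link ρ // LinkAdj ρ p.1 p.2} =>
    (⟨⟨linkSimplex ρ p.1.1 p.1.2 p.2, hcard p⟩, ⟨p.1.1.1, hmem p⟩⟩ :
      Σ σ : {σ : S.Simplex // σ.1.card = N}, {x // x ∈ σ.1.1})) hs ?_
  rintro ⟨⟨v, w⟩, h⟩ ⟨⟨v', w'⟩, h'⟩ heq
  have h1 : linkSimplex ρ v w h = linkSimplex ρ v' w' h' :=
    congrArg (fun q : Σ σ : {σ : S.Simplex // σ.1.card = N}, {x // x ∈ σ.1.1} => q.1.1) heq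
  have h2 : v.1 = v'.1 :=
    congrArg (fun q : Σ σ : {σ : S.Simplex // σ.1.card = N}, {x // x ∈ σ.1.1} => q.2.1) heq
  obtain rfl : v = v' := Subtype.ext h2
  obtain rfl := linkSimplex_injective_right h h' h1
  rfl

end Link

/-! ### Flows on links and the vanishing of `∂∂` -/

namespace Coboundary

variable (δ : S.Coboundary)

open Classical in
/-- The flow on the link of `ρ` induced by `ω`. -/
def linkFlow (ω : S.Simplex → ℂ) (ρ : S.Simplex) (v w : S.link ρ) : ℂ :=
  if h : LinkAdj ρ v w then
    δ.theta ρ (linkCoface ρ v).1 * δ.theta (linkCoface ρ v).1 (linkSimplex ρ v w h) *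
      ω (linkSimplex ρ v w h)
  else 0

/-- This is `δδ = 0`: the two chains of faces from `ρ` to `ρ ∪ {v, w}` carry opposite signs. -/
lemma linkFlow_antisymm (ω : S.Simplex → ℂ) (ρ : S.Simplex) (v w : S.link ρ) :
    δ.linkFlow ω ρ w v = -δ.linkFlow ω ρ v w := by
  unfold linkFlow
  by_cases h : LinkAdj ρ v w
  · rw [dif_pos h, dif_pos h.symm, linkSimplex_symm ρ v w h]
    have h1 := δ.theta_mul_add_theta_mul (linkCoface ρ v).2 (linkCoface ρ w).2
      (isFace_linkSimplex ρ v w h)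
      (by
        have := isFace_linkSimplex ρ w v h.symm
        rwa [linkSimplex_symm ρ v w h] at this)
      (fun h2 => h.1 ((bijective_linkCoface ρ).1 (Subtype.ext h2)))
    linear_combination ω (linkSimplex ρ v w h) * h1
  · rw [dif_neg h, dif_neg fun h' => h h'.symm, neg_zero]

/-- Identifies the divergence at `v` with the term of `ρ ∪ {v}` in the series for `m(ρ) ∂∂ω(ρ)`,
because the edges at `v` are the cofaces of `ρ ∪ {v}`. -/
lemma tsum_linkFlow (ω : S.Simplex → ℂ) (ρ : S.Simplex) (v : S.link ρ) :
    ∑' w, ((S.linkGraph ρ).b v w : ℂ) * δ.linkFlow ω ρ v w =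
      δ.theta ρ (linkCoface ρ v).1 *
        ((S.wt (linkCoface ρ v).1 : ℂ) * δ.boundary ω (linkCoface ρ v).1) := by
  have hsupp : Function.support (fun w => ((S.linkGraph ρ).b v w : ℂ) * δ.linkFlow ω ρ v w) ⊆
      {w | LinkAdj ρ v w} := by
    intro w hw
    by_contra h
    have h' : ¬LinkAdj ρ v w := h
    exact hw (by simp only [linkFlow]; rw [dif_neg h', mul_zero])
  rw [← tsum_subtype_eq_of_support_subset hsupp, boundary,
    mul_inv_cancel_left₀ (Complex.ofReal_ne_zero.2 (S.wt_pos _).ne'), ← tsum_mul_left,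
    ← (Equiv.ofBijective _ (bijective_linkSimplex ρ v)).tsum_eq]
  refine tsum_congr fun w => ?_
  have hw : LinkAdj ρ v w.1 := w.2
  rw [linkFlow, dif_pos hw, linkWeight_of_adj hw, Equiv.ofBijective_apply]
  ring

/-- If the components of all links are recurrent, then `∂∂ω = 0` for `ω ∈ ℓ²` with
`∂ω ∈ D(∂)`. -/
theorem boundary_boundary_eq_zero
    (hrec : ∀ ρ : S.Simplex, (S.linkGraph ρ).ComponentsRecurrent) {ω : S.Simplex → ℂ}
    (hω : S.IsL2 ω) (hω' : δ.boundary ω ∈ S.boundaryDomain) :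
    δ.boundary (δ.boundary ω) = 0 := by
  funext ρ
  have hd : Summable fun v => ‖∑' w, ((S.linkGraph ρ).b v w : ℂ) * δ.linkFlow ω ρ v w‖ := by
    refine (((linkEquiv ρ).summable_iff).2 (hω' ρ)).congr fun v => ?_
    rw [tsum_linkFlow, norm_mul, norm_mul, δ.norm_theta (linkCoface ρ v).2, one_mul,
      Complex.norm_real, Real.norm_eq_abs, abs_of_pos (S.wt_pos _)]
    rfl
  -- The signs have modulus one, so the energy is `∑ m|ω|²` over ordered edges of the link.
  have hE : Summable fun p : S.link ρ × S.link ρ =>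
      (S.linkGraph ρ).b p.1 p.2 * ‖δ.linkFlow ω ρ p.1 p.2‖ ^ 2 := by
    have hsupp : Function.support (fun p : S.link ρ × S.link ρ =>
        (S.linkGraph ρ).b p.1 p.2 * ‖δ.linkFlow ω ρ p.1 p.2‖ ^ 2) ⊆
        {p | LinkAdj ρ p.1 p.2} := by
      intro p hp
      by_contra h
      exact hp (by simp only; rw [linkWeight_of_not_adj h, zero_mul])
    have h1 := summable_subtype_iff_indicator.1
      (show Summable ((fun p : S.link ρ × S.link ρ =>
        (S.linkGraph ρ).b p.1 p.2 * ‖δ.linkFlow ω ρ p.1 p.2‖ ^ 2) ∘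
        (Subtype.val : {p : S.link ρ × S.link ρ | LinkAdj ρ p.1 p.2} → _)) from by
        refine (summable_linkSimplex ρ hω).congr fun p => ?_
        have hp : LinkAdj ρ p.1.1 p.1.2 := p.2
        simp only [Function.comp_apply, linkFlow]
        rw [dif_pos hp, linkWeight_of_adj hp, norm_mul, norm_mul,
          δ.norm_theta (linkCoface ρ _).2, δ.norm_theta (isFace_linkSimplex ρ _ _ hp), one_mul,
          one_mul])
    rwa [Set.indicator_eq_self.2 hsupp] at h1
  have h1 := (hrec ρ).tsum_divergence_eq_zero (a := δ.linkFlow ω ρ)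
    (δ.linkFlow_antisymm ω ρ) hE hd
  rw [boundary, ← (linkEquiv ρ).tsum_eq, Pi.zero_apply]
  refine mul_eq_zero_of_right _ (Eq.trans (tsum_congr fun v => ?_) h1)
  rw [tsum_linkFlow]
  change (S.wt (linkCoface ρ v).1 : ℂ) * δ.theta ρ (linkCoface ρ v).1 *
    δ.boundary ω (linkCoface ρ v).1 = _
  ring

/-- On its domain the Hodge Laplacian acts as `∂δ + δ∂`. -/
theorem ClosedForm.hodgeLaplacian_eq {δ : S.Coboundary} (Q : δ.ClosedForm)
    (hrec : ∀ ρ : S.Simplex, (S.linkGraph ρ).ComponentsRecurrent)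
    (hδ : ∀ φ : S.Simplex → ℂ, (Function.support φ).Finite → S.IsL2 (δ.boundary (δ.toLin φ)))
    (ω : Q.hodgeLaplacian.domain) :
    (Q.hodgeLaplacian ω).1 = δ.boundary (δ.toLin ω.1.1) + δ.toLin (δ.boundary ω.1.1) := by
  obtain ⟨hg, h⟩ := Q.hodgeLaplacian_eq_dirac_dirac ω
  have hω : S.IsL2 ω.1.1 := ω.1.2
  have h1 : δ.toLin ω.1.1 ∈ S.boundaryDomain := δ.toLin_mem_boundaryDomain hδ hω
  -- `∂ω` need not be in `ℓ²` by itself; it is the difference of `(δ + ∂)ω ∈ ℓ²` and `δω`, both in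
  -- `D(∂)`.
  have h2 : δ.boundary ω.1.1 ∈ S.boundaryDomain := by
    intro ρ
    refine Summable.of_nonneg_of_le (fun τ => mul_nonneg (S.wt_pos _).le (norm_nonneg _))
      (fun τ => ?_) ((IsL2.mem_boundaryDomain S hg ρ).add (h1 ρ))
    rw [← mul_add]
    refine mul_le_mul_of_nonneg_left ?_ (S.wt_pos _).le
    have h3 : δ.boundary ω.1.1 τ.1 = δ.dirac ω.1.1 τ.1 - δ.toLin ω.1.1 τ.1 := by
      simp [dirac]
    rw [h3]
    exact norm_sub_le _ _
  rw [h, dirac]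
  nth_rw 1 [dirac]
  nth_rw 1 [dirac]
  rw [map_add, δ.sq_zero, zero_add, δ.boundary_add h1 h2,
    δ.boundary_boundary_eq_zero hrec hω h2, add_zero, add_comm]

end Coboundary

end WeightedComplex

end

theorem mainTheorem4 {X : Type*} (S : WeightedComplex X) (δ : S.Coboundary) (Q : δ.ClosedForm)
    (hrec : ∀ ρ : S.Simplex, (S.linkGraph ρ).ComponentsRecurrent)
    (hδ : ∀ φ : S.Simplex → ℂ, (Function.support φ).Finite →
      S.IsL2 (δ.boundary (δ.toLin φ))) :
    -- the Hodge Laplacian is a self-adjoint operator that represents the form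
    IsSelfAdjoint Q.hodgeLaplacian ∧
    (∀ ω : Q.hodgeLaplacian.domain, ∃ hω : (ω : S.L2) ∈ Q.domain, ∀ η : Q.domain,
      Q.form ⟨ω, hω⟩ η = inner ℂ (η : S.L2) (Q.hodgeLaplacian ω)) ∧
    -- on its domain it acts as `∂δ + δ∂`, all terms being defined
    (∀ ω : Q.hodgeLaplacian.domain,
      ω.1.1 ∈ S.boundaryDomain ∧ δ.toLin ω.1.1 ∈ S.boundaryDomain ∧
      (Q.hodgeLaplacian ω).1 = δ.boundary (δ.toLin ω.1.1) + δ.toLin (δ.boundary ω.1.1)) ∧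
    -- it acts separately on each degree, again as `∂δ + δ∂`
    (∀ (k : ℤ) (ω : Q.hodgeLaplacian.domain),
      S.degreePart k ω.1.1 ∈ S.boundaryDomain ∧
      δ.toLin (S.degreePart k ω.1.1) ∈ S.boundaryDomain ∧
      S.degreePart k (Q.hodgeLaplacian ω).1 =
        δ.boundary (δ.toLin (S.degreePart k ω.1.1)) +
          δ.toLin (δ.boundary (S.degreePart k ω.1.1))) ∧
    -- in particular it maps forms of degree `k` in its domain to forms of degree `k`
    (∀ (k : ℤ) (ω : Q.hodgeLaplacian.domain), S.degreePart k ω.1.1 = ω.1.1 →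
      S.degreePart k (Q.hodgeLaplacian ω).1 = (Q.hodgeLaplacian ω).1) := by
  -- The formula for `ω` is cut to degree `k`, using that `δ` raises and `∂` lowers the degree by
  -- one. The part `ω_k` itself is not claimed to lie in the domain of `Δ^H`.
  have hdeg : ∀ (k : ℤ) (ω : Q.hodgeLaplacian.domain),
      S.degreePart k (Q.hodgeLaplacian ω).1 =
        δ.boundary (δ.toLin (S.degreePart k ω.1.1)) +
          δ.toLin (δ.boundary (S.degreePart k ω.1.1)) := by
    intro k ω
    have h1 : δ.boundary (S.degreePart k ω.1.1) = S.degreePart (k - 1) (δ.boundary ω.1.1) := by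
      rw [← δ.boundary_degreePart, sub_add_cancel]
    rw [Q.hodgeLaplacian_eq hrec hδ ω, WeightedComplex.Coboundary.degreePart_add,
      δ.toLin_degreePart, δ.boundary_degreePart, h1, δ.toLin_degreePart, sub_add_cancel]
  have hL2 : ∀ ω : Q.hodgeLaplacian.domain, S.IsL2 ω.1.1 := fun ω => ω.1.2
  have hL2k : ∀ (k : ℤ) (ω : Q.hodgeLaplacian.domain), S.IsL2 (S.degreePart k ω.1.1) :=
    fun k ω => WeightedComplex.Coboundary.isL2_degreePart k (hL2 ω)
  refine ⟨Q.isSelfAdjoint_hodgeLaplacian, Q.hodgeLaplacian_spec, fun ω => ?_, fun k ω => ?_,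
    fun k ω hω => ?_⟩
  · exact ⟨WeightedComplex.IsL2.mem_boundaryDomain S (hL2 ω),
      δ.toLin_mem_boundaryDomain hδ (hL2 ω), Q.hodgeLaplacian_eq hrec hδ ω⟩
  · exact ⟨WeightedComplex.IsL2.mem_boundaryDomain S (hL2k k ω),
      δ.toLin_mem_boundaryDomain hδ (hL2k k ω), hdeg k ω⟩
  · rw [hdeg k ω, hω, Q.hodgeLaplacian_eq hrec hδ ω]
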